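/- Let $N\ge 1$, let $B=[b_{ij}]\in\mathbb{R}^{N\times N}$ be the weighted adjacency matrix (entries of either sign, $b_{ii}=0$) of a strongly connected signed digraph, let $\sigma_1,\dots,\sigma_N>0$, $\Sigma=\mathrm{diag}(\sigma_1,\dots,\sigma_N)$ and $E=B-\Sigma$. Consider the stubborn neutrals dynamics $$\dot x=\mathrm{diag}(x)^2\,E\,x,\qquad t\ge 0,\qquad x(0)\in[-1,1]^N .$$ Write $\rho(\cdot)$ for the spectral radius, $H(M)=\tfrac12(M+M^{\mathsf T})$, and call a real square matrix $M$ eventually positive if there is $k_0\geq 1$ such that all entries of $M^k$ are positive for every $k\ge k_0$. Vector inequalities are componentwise and strict in every component, and $\|v\|_\infty=\max_i|v_i|$. Suppose that one of the following holds: (A1) $B$ is eventually positive and $\sigma_1=\dots=\sigma_N\ge\rho(B)$; in this case put $C=B$ and $d=\sigma_1$; (A2) $B$ is not eventually positive, but for some $d\in\mathbb{R}$ the matrix $C=B+dI-\Sigma$ (so that $E=C-dI$) is eventually positive and $d\ge\rho(C)$. Suppose moreover that there is a diagonal matrix $\Gamma$ with positive diagonal entries such that $H(\Gamma E)$ is negative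 semidefinite and $\mathrm{rank}\,H(\Gamma E)=\mathrm{rank}\,E$. Then for every $x(0)\in[-1,1]^N$ there is a solution on $[0,\infty)$, the matrix $C$ has a positive right eigenvector for the eigenvalue $\rho(C)$, and the following holds for every solution $x$ on $[0,\infty)$ with $x(0)\in[-1,1]^N$ and every positive right eigenvector $v_r$ of $C$ for $\rho(C)$. If $d=\rho(C)$, then: 1) if $x(0)>\mathbf 0$, then $\lim_{t\to\infty}x(t)=\alpha v_r$ for some $\alpha>0$, and $\alpha\in\big(0,\tfrac{1}{\|v_r\|_\infty}\big]$ provided that $x(t)\in[-1,1]^N$ for all $t\ge0$; 2) if $x(0)<\mathbf 0$, then $\lim_{t\to\infty}x(t)=\alpha v_r$ for some $\alpha<0$, and $\alpha\in\big[-\tfrac{1}{\|v_r\|_\infty},0\big)$ provided that $x(t)\in[-1,1]^N$ for all $t\ge0$; 3) for all other $x(0)\in[-1,1]^N$, $\lim_{t\to\infty}x(t)=\mathbf 0$. If $d>\rho(C)$, then $\lim_{t\to\infty}x(t)=\mathbf 0$ for every $x(0)\in[-1,1]^N$. -/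

import Mathlib

namespace OpinionDynamics

open Matrix

/-- The spectral radius of a real square matrix: the largest modulus of its complex eigenvalues. -/
noncomputable def specRad {N : ℕ} (A : Matrix (Fin N) (Fin N) ℝ) : ℝ :=
  (spectralRadius ℂ (A.map (algebraMap ℝ ℂ))).toReal

/-- `A` is eventually positive: for some positive `k₀`, all powers `A ^ k` with `k ≥ k₀` are
entrywise positive. -/
def EventuallyPositive {N : ℕ} (A : Matrix (Fin N) (Fin N) ℝ) : Prop :=
  ∃ k₀ : ℕ, 0 < k₀ ∧ ∀ k : ℕ, k₀ ≤ k → ∀ i j : Fin N, 0 < (A ^ k) i j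

/-- The signed digraph with an edge `(i, j)` whenever `B i j ≠ 0` is strongly connected:
any two distinct nodes are joined by a directed path. -/
def StronglyConnected {N : ℕ} (B : Matrix (Fin N) (Fin N) ℝ) : Prop :=
  ∀ i j : Fin N, i ≠ j → Relation.TransGen (fun k l : Fin N => B k l ≠ 0) i j

/-- The symmetric part `H(A) = (A + Aᵀ) / 2`. -/
noncomputable def symPart {N : ℕ} (A : Matrix (Fin N) (Fin N) ℝ) : Matrix (Fin N) (Fin N) ℝ :=
  (1 / 2 : ℝ) • (A + Aᵀ)

/-- The coupling matrix `E = B - Σ` with `Σ = diag(σ₁, …, σ_N)`. -/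
def couplingMatrix {N : ℕ} (B : Matrix (Fin N) (Fin N) ℝ) (σ : Fin N → ℝ) :
    Matrix (Fin N) (Fin N) ℝ :=
  B - diagonal σ

/-- First case: `B` is eventually positive, and all `σ i` are equal and at least `ρ(B)`. -/
def Assumption1 {N : ℕ} (B : Matrix (Fin N) (Fin N) ℝ) (σ : Fin N → ℝ) : Prop :=
  EventuallyPositive B ∧ (∀ i j : Fin N, σ i = σ j) ∧ ∀ i : Fin N, specRad B ≤ σ i

/-- Second case: `B` is not eventually positive, but `C = B + D` with `D = d I - Σ`
(so that `B - Σ = C - d I`) is eventually positive, and `d ≥ ρ(C)`. -/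
def Assumption2 {N : ℕ} (B : Matrix (Fin N) (Fin N) ℝ) (σ : Fin N → ℝ)
    (C : Matrix (Fin N) (Fin N) ℝ) (d : ℝ) : Prop :=
  ¬ EventuallyPositive B ∧
    C = B + (d • (1 : Matrix (Fin N) (Fin N) ℝ) - diagonal σ) ∧
    EventuallyPositive C ∧ specRad C ≤ d

/-- `v` is a positive right eigenvector of `C` for the eigenvalue `ρ(C)`. -/
def IsPositiveEigenvector {N : ℕ} (C : Matrix (Fin N) (Fin N) ℝ) (v : Fin N → ℝ) : Prop :=
  (∀ i : Fin N, 0 < v i) ∧ C *ᵥ v = specRad C • v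

/-- The opinion space `[-1, 1]^N`. -/
def opinionCube (N : ℕ) : Set (Fin N → ℝ) :=
  {x | ∀ i : Fin N, x i ∈ Set.Icc (-1 : ℝ) 1}

/-- `x` solves `x' = A(x) E x` with `A(x) = diag(x)²` (stubborn neutrals) on `[0, ∞)`;
the derivative at `0` is one-sided. -/
def IsStubbornNeutralsSolution {N : ℕ} (E : Matrix (Fin N) (Fin N) ℝ)
    (x : ℝ → Fin N → ℝ) : Prop :=
  ∀ t : ℝ, 0 ≤ t →
    HasDerivWithinAt x ((diagonal (x t)) ^ 2 *ᵥ (E *ᵥ x t)) (Set.Ici 0) t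

end OpinionDynamics

/-!
Write `D(x) = -xᵀ Γ E x`, a positive semidefinite form by assumption. The kernel of `E` is contained
in that of `H(Γ E)`, and equality of the ranks makes them equal, so `D` vanishes only on the kernel
of `E` (`mulVec_eq_zero_of_dissipation_eq_zero`). By Perron–Frobenius theory for eventually positive
matrices, this kernel is spanned by the positive eigenvector if `d = ρ(C)`, and is zero if
`d > ρ(C)`. Coordinates of solutions keep their signs, since `xᵢ' = xᵢ² (E x)ᵢ`. There are two
regimes, each with its own Lyapunov function.

*The form `D` is definite on a closed cone `K` described by weak signs of coordinates, which contains
the solution.* This holds for `K` the whole space if `d > ρ(C)`, and for the vectors with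
`xᵢ ≤ 0 ≤ xⱼ` if `d = ρ(C)`. The proper function `½ ∑ γᵢ log (1 + xᵢ²)` has derivative
`∑ γᵢ gᵢ (E x)ᵢ` along solutions, where `gᵢ = xᵢ³ / (1 + xᵢ²)` lies in the same cone and differs from
`x` by a bounded vector. The derivative is therefore at most `-c ‖g‖² + O(‖g‖)`, which is negative
far from the origin (`exists_logEnergy_deriv_le`). All solutions in `K` thus enter a ball of fixed
radius; the field is homogeneous of degree three, so `a x(a² t)` is a solution along with `x`, and
letting `a` tend to infinity shows that `x` tends to zero (`tendsto_zero_of_mem_cone`).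

*The solution is positive and `d = ρ(C)`.* For every positive `p` in the kernel of `E`, the relative
energy `∑ γᵢ (pᵢ/xᵢ - 1 - log (pᵢ/xᵢ))` has derivative `-D(x - p) ≤ 0`, and its sublevel sets are
relatively compact in the open orthant. Hence there is an accumulation point with `D(p - v) = 0`,
which is a positive equilibrium; the energy relative to it decreases to zero
(`exists_tendsto_of_pos`). Negative solutions are treated by the symmetry `x ↦ -x`.

Both Lyapunov functions give bounds independent of the interval of existence, and with them global
existence (`exists_isIntegralCurveOn_Ici_of_bound`).
-/

/-! ### Global solutions of autonomous equations from a priori bounds -/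

/-- An integral curve on `[0, T]` is differentiable from the right on `[0, T)`. -/
theorem IsIntegralCurveOn.hasDerivWithinAt_Ici {V : Type*} [NormedAddCommGroup V] [NormedSpace ℝ V]
    {F : V → V} {α : ℝ → V} {T t : ℝ}
    (hα : IsIntegralCurveOn α (fun _ => F) (Set.Icc 0 T)) (ht : t ∈ Set.Ico 0 T) :
    HasDerivWithinAt α (F (α t)) (Set.Ici t) t :=
  (hα t (Set.Ico_subset_Icc_self ht)).mono_of_mem_nhdsWithin (Icc_mem_nhdsGE_of_mem ht)

theorem exists_isIntegralCurveOn_Icc_of_lipschitz_of_bounded {V : Type*} [NormedAddCommGroup V]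
    [NormedSpace ℝ V] [CompleteSpace V] {F : V → V} {K L : NNReal} (hK : LipschitzWith K F)
    (hL : ∀ x, ‖F x‖ ≤ L) (x₀ : V) {T : ℝ} (hT : 0 ≤ T) :
    ∃ α : ℝ → V, α 0 = x₀ ∧ IsIntegralCurveOn α (fun _ => F) (Set.Icc 0 T) := by
  have hPL : IsPicardLindelof (fun _ => F) (⟨0, le_rfl, hT⟩ : Set.Icc (0 : ℝ) T) x₀
      (L * T.toNNReal) 0 L K := by
    refine IsPicardLindelof.of_time_independent (fun x _ => hL x) hK.lipschitzOnWith ?_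
    simp [hT]
  exact hPL.exists_eq_forall_mem_Icc_hasDerivWithinAt₀

theorem exists_isIntegralCurveOn_Ici_of_lipschitz_of_bounded {V : Type*} [NormedAddCommGroup V]
    [NormedSpace ℝ V] [CompleteSpace V] {F : V → V} {K L : NNReal} (hK : LipschitzWith K F)
    (hL : ∀ x, ‖F x‖ ≤ L) (x₀ : V) :
    ∃ α : ℝ → V, α 0 = x₀ ∧ IsIntegralCurveOn α (fun _ => F) (Set.Ici 0) := by
  choose β hβ0 hβ using fun n : ℕ =>
    exists_isIntegralCurveOn_Icc_of_lipschitz_of_bounded hK hL x₀ (Nat.cast_nonneg n)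
  have huniq : ∀ m n : ℕ, m ≤ n → Set.EqOn (β m) (β n) (Set.Icc 0 (m : ℝ)) := by
    intro m n hmn
    have hn := (hβ n).mono (Set.Icc_subset_Icc_right (Nat.cast_le.2 hmn))
    exact ODE_solution_unique (v := fun _ => F) (fun _ => hK)
      (fun t ht => ((hβ m) t ht).continuousWithinAt) (fun t ht => (hβ m).hasDerivWithinAt_Ici ht)
      (fun t ht => (hn t ht).continuousWithinAt) (fun t ht => hn.hasDerivWithinAt_Ici ht)
      ((hβ0 m).trans (hβ0 n).symm)
  refine ⟨fun t => β ⌈t⌉₊ t, by simpa using hβ0 0, fun t ht => ?_⟩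
  have ht : 0 ≤ t := ht
  set n := ⌈t⌉₊ + 1 with hn
  have htn : t < n := by
    have := Nat.le_ceil t
    rw [hn]; push_cast; linarith
  have heq : ∀ s ∈ Set.Icc 0 (n : ℝ), β ⌈s⌉₊ s = β n s := fun s hs =>
    huniq _ _ (Nat.ceil_le.2 hs.2) ⟨hs.1, Nat.le_ceil s⟩
  have h1 := (hβ n) t ⟨ht, htn.le⟩
  rw [← heq t ⟨ht, htn.le⟩] at h1
  refine (h1.congr heq (heq t ⟨ht, htn.le⟩)).mono_of_mem_nhdsWithin ?_
  rw [← Set.Ici_inter_Iic, Set.inter_comm]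
  exact Filter.inter_mem (mem_nhdsWithin_of_mem_nhds (Iic_mem_nhds htn)) self_mem_nhdsWithin

/-- Retraction of `ι → ℝ` onto the closed ball of radius `R` of the sup norm. -/
noncomputable def clip {ι : Type*} (R : ℝ) (x : ι → ℝ) : ι → ℝ := fun i => max (-R) (min R (x i))

theorem lipschitzWith_clip {ι : Type*} [Fintype ι] (R : ℝ) :
    LipschitzWith 1 (clip R : (ι → ℝ) → ι → ℝ) := by
  refine LipschitzWith.of_dist_le_mul fun x y => ?_
  rw [NNReal.coe_one, one_mul]
  refine (dist_pi_le_iff dist_nonneg).2 fun i => ?_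
  have h := ((LipschitzWith.eval (α := fun _ : ι => ℝ) i).const_min R).const_max (-R)
  simpa [clip] using h.dist_le_mul x y

theorem norm_clip_le {ι : Type*} [Fintype ι] {R : ℝ} (hR : 0 ≤ R) (x : ι → ℝ) :
    ‖clip R x‖ ≤ R := by
  refine (pi_norm_le_iff_of_nonneg hR).2 fun i => abs_le.2 ⟨le_max_left _ _, ?_⟩
  exact max_le (by linarith) (min_le_left _ _)

theorem clip_eq_self {ι : Type*} [Fintype ι] {R : ℝ} {x : ι → ℝ} (hx : ‖x‖ ≤ R) :
    clip R x = x := by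
  funext i
  have h := abs_le.1 ((norm_le_pi_norm x i).trans hx)
  simp [clip, h.1, h.2]

/-- If every solution on a compact interval `[0, T]` starting at `x₀` satisfies `‖α T‖ ≤ R`, with
`R` independent of `T`, then there is a solution on `[0, ∞)`: the field modified outside the ball
of radius `R + 1` has a global solution, and this solution cannot leave that ball. -/
theorem exists_isIntegralCurveOn_Ici_of_bound {ι : Type*} [Fintype ι] {F : (ι → ℝ) → ι → ℝ}
    (hF : LocallyLipschitz F) (x₀ : ι → ℝ) (R : ℝ)
    (hbound : ∀ T, 0 ≤ T → ∀ α : ℝ → ι → ℝ, α 0 = x₀ →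
      IsIntegralCurveOn α (fun _ => F) (Set.Icc 0 T) → ‖α T‖ ≤ R) :
    ∃ α : ℝ → ι → ℝ, α 0 = x₀ ∧ IsIntegralCurveOn α (fun _ => F) (Set.Ici 0) := by
  have hx₀ : ‖x₀‖ ≤ R := by
    have h := hbound 0 le_rfl (fun t => x₀ + t • F x₀) (by simp) fun t ht => by
      obtain rfl : t = 0 := by simpa using ht
      simpa using (((hasDerivAt_id (0 : ℝ)).smul_const (F x₀)).const_add x₀).hasDerivWithinAt
    simpa using h
  have hR : 0 ≤ R + 1 := by linarith [norm_nonneg x₀]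
  obtain ⟨K, hK⟩ := (hF.locallyLipschitzOn (s := Metric.closedBall 0 (R + 1))
    ).exists_lipschitzOnWith_of_compact (isCompact_closedBall _ _)
  obtain ⟨L, hL⟩ := (isCompact_closedBall (0 : ι → ℝ) (R + 1)).exists_bound_of_continuousOn
    hF.continuous.continuousOn
  have hmem : ∀ x : ι → ℝ, clip (R + 1) x ∈ Metric.closedBall (0 : ι → ℝ) (R + 1) := fun x =>
    mem_closedBall_zero_iff.2 (norm_clip_le hR x)
  have hlip : LipschitzWith K fun x => F (clip (R + 1) x) := by
    have h := hK.comp ((lipschitzWith_clip (ι := ι) (R + 1)).lipschitzOnWith (s := Set.univ))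
      fun x _ => hmem x
    rw [mul_one, lipschitzOnWith_univ] at h
    exact h
  obtain ⟨α, hα0, hα⟩ := exists_isIntegralCurveOn_Ici_of_lipschitz_of_bounded
    (L := L.toNNReal) hlip (fun x => (hL _ (hmem x)).trans (Real.le_coe_toNNReal L)) x₀
  have hcont : ContinuousOn (fun t => ‖α t‖) (Set.Ici 0) := fun t ht =>
    (hα t ht).continuousWithinAt.norm
  have hsol : ∀ T, 0 ≤ T → (∀ t ∈ Set.Icc 0 T, ‖α t‖ ≤ R + 1) → ‖α T‖ ≤ R := by
    intro T hT h
    refine hbound T hT α hα0 fun t ht => ?_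
    have := (hα t ht.1).mono
      (Set.Icc_subset_Ici_self : Set.Icc 0 T ⊆ Set.Ici 0)
    simpa only [clip_eq_self (h t ht)] using this
  have hle : ∀ t, 0 ≤ t → ‖α t‖ ≤ R + 1 := by
    by_contra! hne
    obtain ⟨t, ht, hlt⟩ := hne
    -- the first time at which the norm equals `R + 1`
    let S : Set ℝ := Set.Icc 0 t ∩ (fun s => ‖α s‖) ⁻¹' {R + 1}
    have hSc : IsCompact S :=
      (isCompact_Icc).of_isClosed_subset
        ((hcont.mono Set.Icc_subset_Ici_self).preimage_isClosed_of_isClosed isClosed_Icc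
          isClosed_singleton) Set.inter_subset_left
    have hSne : S.Nonempty := by
      obtain ⟨s, hs, hs'⟩ := intermediate_value_Icc ht (hcont.mono Set.Icc_subset_Ici_self)
        (show R + 1 ∈ Set.Icc ‖α 0‖ ‖α t‖ from ⟨by rw [hα0]; linarith, hlt.le⟩)
      exact ⟨s, hs, hs'⟩
    obtain ⟨τ, hτ, hmin⟩ := hSc.exists_isLeast hSne
    have h1 : ‖α τ‖ = R + 1 := hτ.2
    have h2 : ‖α τ‖ ≤ R := by
      refine hsol τ hτ.1.1 fun s hs => ?_
      by_contra! hs'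
      obtain ⟨u, hu, hu'⟩ := intermediate_value_Icc hs.1
        (hcont.mono Set.Icc_subset_Ici_self)
        (show R + 1 ∈ Set.Icc ‖α 0‖ ‖α s‖ from ⟨by rw [hα0]; linarith, hs'.le⟩)
      have hτu := hmin ⟨⟨hu.1, hu.2.trans (hs.2.trans hτ.1.2)⟩, hu'⟩
      have : s = τ := le_antisymm hs.2 (hτu.trans hu.2)
      rw [this] at hs'
      linarith
    linarith
  refine ⟨α, hα0, fun t ht => ?_⟩
  simpa only [clip_eq_self (hle t ht)] using hα t ht

/-! ### Perron–Frobenius theory of eventually positive matrices -/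

open Matrix in
theorem Matrix.mulVec_pos_of_pos {ι : Type*} [Fintype ι] {A : Matrix ι ι ℝ}
    (hA : ∀ i j, 0 < A i j) {x : ι → ℝ} (hx : 0 ≤ x) (hne : x ≠ 0) (i : ι) : 0 < (A *ᵥ x) i := by
  obtain ⟨j, hj⟩ := Function.ne_iff.1 hne
  exact Finset.sum_pos' (fun k _ => mul_nonneg (hA i k).le (hx k))
    ⟨j, Finset.mem_univ j, mul_pos (hA i j) (lt_of_le_of_ne (hx j) (Ne.symm hj))⟩

open Matrix in
/-- Perron's theorem, by the Collatz–Wielandt argument: the largest `r` for which some vector `x` of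
the simplex satisfies `r x ≤ A x` is an eigenvalue. Otherwise `A x - r x` is nonnegative and nonzero,
hence `A (A x) - r (A x)` is strictly positive and `A x` allows a larger `r`. -/
theorem Matrix.exists_pos_eigenvector_of_pos {ι : Type*} [Fintype ι] [Nonempty ι]
    {A : Matrix ι ι ℝ} (hA : ∀ i j, 0 < A i j) :
    ∃ r : ℝ, 0 < r ∧ ∃ v : ι → ℝ, (∀ i, 0 < v i) ∧ A *ᵥ v = r • v := by
  classical
  set L : ℝ := ∑ i, ∑ j, A i j with hL
  let S : Set (ℝ × (ι → ℝ)) :=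
    (Set.Icc 0 L ×ˢ stdSimplex ℝ ι) ∩ {p | ∀ i, p.1 * p.2 i ≤ (A *ᵥ p.2) i}
  have hclosed : IsClosed {p : ℝ × (ι → ℝ) | ∀ i, p.1 * p.2 i ≤ (A *ᵥ p.2) i} := by
    simp only [Set.ofPred_forall]
    refine isClosed_iInter fun i => isClosed_le (by fun_prop) ?_
    simp only [Matrix.mulVec, dotProduct]
    fun_prop
  have hS : IsCompact S := (isCompact_Icc.prod (isCompact_stdSimplex ℝ ι)).inter_right hclosed
  have hmemS : ∀ r : ℝ, 0 ≤ r → ∀ x ∈ stdSimplex ℝ ι, (∀ i, r * x i ≤ (A *ᵥ x) i) →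
      (r, x) ∈ S := by
    intro r hr x hx h
    refine ⟨⟨⟨hr, ?_⟩, hx⟩, h⟩
    calc r = ∑ i, r * x i := by rw [← Finset.mul_sum, hx.2, mul_one]
      _ ≤ ∑ i, (A *ᵥ x) i := Finset.sum_le_sum fun i _ => h i
      _ ≤ L := Finset.sum_le_sum fun i _ => Finset.sum_le_sum fun j _ =>
          mul_le_of_le_one_right (hA i j).le (mem_Icc_of_mem_stdSimplex hx j).2
  have hne : S.Nonempty := by
    obtain ⟨i⟩ := ‹Nonempty ι›
    refine ⟨_, hmemS 0 le_rfl _ (single_mem_stdSimplex ℝ i) fun j => ?_⟩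
    rw [zero_mul]
    exact Finset.sum_nonneg fun k _ =>
      mul_nonneg (hA j k).le ((single_mem_stdSimplex ℝ i).1 k)
  obtain ⟨⟨r, x⟩, ⟨⟨⟨hr0, -⟩, hx⟩, hle⟩, hmax⟩ :=
    hS.exists_isMaxOn hne continuous_fst.continuousOn
  have hx0 : x ≠ 0 := by
    rintro rfl
    simpa using hx.2
  have hy : ∀ i, 0 < (A *ᵥ x) i := mulVec_pos_of_pos hA hx.1 hx0
  have heig : A *ᵥ x = r • x := by
    by_contra hcon
    have hw : ∀ i, 0 < (A *ᵥ (A *ᵥ x - r • x)) i :=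
      mulVec_pos_of_pos hA (fun i => sub_nonneg.2 (hle i)) (sub_ne_zero.2 hcon)
    obtain ⟨i₀, -, hi₀⟩ := Finset.exists_min_image Finset.univ
      (fun i => (A *ᵥ (A *ᵥ x - r • x)) i / (A *ᵥ x) i) Finset.univ_nonempty
    set ε := (A *ᵥ (A *ᵥ x - r • x)) i₀ / (A *ᵥ x) i₀ with hε
    have hεpos : 0 < ε := div_pos (hw i₀) (hy i₀)
    set s := ∑ i, (A *ᵥ x) i with hs
    have hspos : 0 < s := Finset.sum_pos (fun i _ => hy i) Finset.univ_nonempty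
    have hmem : (r + ε, s⁻¹ • (A *ᵥ x)) ∈ S := by
      refine hmemS _ (by positivity) _ ⟨fun i => ?_, ?_⟩ fun i => ?_
      · exact mul_nonneg (inv_nonneg.2 hspos.le) (hy i).le
      · simp only [Pi.smul_apply, smul_eq_mul]
        rw [← Finset.mul_sum, ← hs, inv_mul_cancel₀ hspos.ne']
      · have h1 := hi₀ i (Finset.mem_univ i)
        rw [le_div_iff₀ (hy i), mulVec_sub, mulVec_smul] at h1
        simp only [Pi.sub_apply, Pi.smul_apply, smul_eq_mul] at h1
        rw [mulVec_smul]
        simp only [Pi.smul_apply, smul_eq_mul]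
        rw [mul_left_comm]
        refine mul_le_mul_of_nonneg_left ?_ (inv_nonneg.2 hspos.le)
        linarith
    have := hmax hmem
    simp only [Set.mem_ofPred_eq] at this
    linarith
  have hrx : ∀ i, 0 < r * x i := fun i => by
    have := hy i
    rwa [heig] at this
  have hr : 0 < r := by
    obtain ⟨i⟩ := ‹Nonempty ι›
    exact pos_of_mul_pos_left (hrx i) (hx.1 i)
  exact ⟨r, hr, x, fun i => pos_of_mul_pos_right (hrx i) hr0, heig⟩

open Matrix in
/-- The weighted sup norm `max |z i| / v i` shows that an eigenvalue with a positive eigenvector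
dominates all complex eigenvalues of a nonnegative matrix. -/
theorem Matrix.norm_eigenvalue_le_of_pos_eigenvector {ι : Type*} [Fintype ι]
    {A : Matrix ι ι ℝ} (hA : ∀ i j, 0 ≤ A i j) {r : ℝ} {v : ι → ℝ} (hv : ∀ i, 0 < v i)
    (hAv : A *ᵥ v = r • v) {l : ℂ} {z : ι → ℂ} (hz : z ≠ 0)
    (hAz : A.map (algebraMap ℝ ℂ) *ᵥ z = l • z) : ‖l‖ ≤ r := by
  obtain ⟨j, hj⟩ := Function.ne_iff.1 hz
  obtain ⟨i, -, hi⟩ := Finset.exists_max_image Finset.univ (fun i => ‖z i‖ / v i)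
    ⟨j, Finset.mem_univ j⟩
  set m := ‖z i‖ / v i with hm
  have hmpos : 0 < m :=
    (div_pos (norm_pos_iff.2 hj) (hv j)).trans_le (hi j (Finset.mem_univ j))
  have hzi : ‖z i‖ = m * v i := by rw [hm, div_mul_cancel₀ _ (hv i).ne']
  have h1 : ‖l‖ * ‖z i‖ ≤ m * (r * v i) := by
    have h2 : l * z i = ∑ k, (A i k : ℂ) * z k := by
      have := congrFun hAz i
      simpa [mulVec, dotProduct] using this.symm
    have h3 : r * v i = ∑ k, A i k * v k := by
      have := congrFun hAv i
      simpa [mulVec, dotProduct] using this.symm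
    rw [← norm_mul, h2, h3, Finset.mul_sum]
    refine norm_sum_le_of_le _ fun k _ => ?_
    rw [norm_mul, Complex.norm_real, Real.norm_of_nonneg (hA i k), mul_left_comm]
    exact mul_le_mul_of_nonneg_left ((div_le_iff₀ (hv k)).1 (hi k (Finset.mem_univ k))) (hA i k)
  rw [hzi] at h1
  have h4 : 0 < m * v i := mul_pos hmpos (hv i)
  refine le_of_mul_le_mul_right (h1.trans_eq ?_) h4
  ring

open Matrix in
/-- The Perron eigenvalue of a positive matrix is geometrically simple. -/
theorem Matrix.exists_eq_smul_of_pos {ι : Type*} [Fintype ι] [Nonempty ι]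
    {A : Matrix ι ι ℝ} (hA : ∀ i j, 0 < A i j) {r : ℝ} {v w : ι → ℝ} (hv : ∀ i, 0 < v i)
    (hAv : A *ᵥ v = r • v) (hAw : A *ᵥ w = r • w) : ∃ s : ℝ, w = s • v := by
  obtain ⟨i, -, hi⟩ := Finset.exists_min_image Finset.univ (fun i => w i / v i)
    Finset.univ_nonempty
  refine ⟨w i / v i, ?_⟩
  by_contra hne
  have hpos := mulVec_pos_of_pos hA (x := w - (w i / v i) • v)
    (fun k => sub_nonneg.2 ((le_div_iff₀ (hv k)).1 (hi k (Finset.mem_univ k))))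
    (sub_ne_zero.2 hne) i
  have hzero : (A *ᵥ (w - (w i / v i) • v)) i = 0 := by
    rw [mulVec_sub, mulVec_smul, hAv, hAw]
    simp only [Pi.sub_apply, Pi.smul_apply, smul_eq_mul]
    field_simp [(hv i).ne']
    ring
  exact hpos.ne' hzero

open Matrix in
theorem Matrix.pow_mulVec_eq_of_mulVec_eq {ι R : Type*} [Fintype ι] [DecidableEq ι] [CommRing R]
    {A : Matrix ι ι R} {l : R} {v : ι → R} (h : A *ᵥ v = l • v) (k : ℕ) :
    (A ^ k) *ᵥ v = l ^ k • v := by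
  induction k with
  | zero => simp
  | succ k ih => rw [pow_succ, ← mulVec_mulVec, h, mulVec_smul, ih, smul_smul, pow_succ, mul_comm]

namespace OpinionDynamics

open Matrix

theorem mem_spectrum_iff_exists_mulVec_eq {N : ℕ} {A : Matrix (Fin N) (Fin N) ℂ} {l : ℂ} :
    l ∈ spectrum ℂ A ↔ ∃ z : Fin N → ℂ, z ≠ 0 ∧ A *ᵥ z = l • z := by
  rw [← Matrix.spectrum_toLin', ← Module.End.hasEigenvalue_iff_mem_spectrum]
  constructor
  · intro h
    obtain ⟨z, hz⟩ := h.exists_hasEigenvector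
    exact ⟨z, hz.2, by simpa using hz.apply_eq_smul⟩
  · rintro ⟨z, hz, h⟩
    exact Module.End.hasEigenvalue_of_hasEigenvector
      ⟨Module.End.mem_eigenspace_iff.2 (by simpa using h), hz⟩

/-- An eventually positive matrix has a positive eigenvector, whose eigenvalue `μ` is positive and
dominates all eigenvalues. The Perron eigenvector `v` of a positive power `C ^ k` works: `C v` is
again in the one-dimensional eigenspace of `C ^ k`, so `C v = μ v`, and `μ` is positive because
`μ ^ k` and `μ ^ (k + 1)` are. -/
theorem EventuallyPositive.exists_dominant {N : ℕ} (hN : 0 < N) {C : Matrix (Fin N) (Fin N) ℝ}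
    (hC : EventuallyPositive C) :
    ∃ μ : ℝ, 0 < μ ∧ (∃ v : Fin N → ℝ, (∀ i, 0 < v i) ∧ C *ᵥ v = μ • v) ∧
      ∀ (l : ℂ) (z : Fin N → ℂ), z ≠ 0 → C.map (algebraMap ℝ ℂ) *ᵥ z = l • z → ‖l‖ ≤ μ := by
  have : Nonempty (Fin N) := ⟨⟨0, hN⟩⟩
  obtain ⟨k, hk, hpos⟩ := hC
  have hCk := hpos k le_rfl
  obtain ⟨r, hr, v, hv, hCv⟩ := exists_pos_eigenvector_of_pos hCk
  obtain ⟨μ, hμ⟩ : ∃ μ : ℝ, C *ᵥ v = μ • v := by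
    refine exists_eq_smul_of_pos hCk hv hCv ?_
    rw [mulVec_mulVec, ← pow_succ, pow_succ', ← mulVec_mulVec, hCv, mulVec_smul]
  have hpow : ∀ m, k ≤ m → 0 < μ ^ m := by
    intro m hm
    have h1 := mulVec_pos_of_pos (hpos m hm) (x := v) (fun i => (hv i).le)
      (fun h => (hv ⟨0, hN⟩).ne' (congrFun h _)) ⟨0, hN⟩
    rw [pow_mulVec_eq_of_mulVec_eq hμ] at h1
    exact pos_of_mul_pos_left h1 (hv _).le
  have hμpos : 0 < μ := by
    have h1 := hpow (k + 1) (Nat.le_succ k)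
    rw [pow_succ] at h1
    exact pos_of_mul_pos_right h1 (hpow k le_rfl).le
  refine ⟨μ, hμpos, ⟨v, hv, hμ⟩, fun l z hz hl => ?_⟩
  have h1 : (C ^ k).map (algebraMap ℝ ℂ) *ᵥ z = l ^ k • z := by
    have h2 := pow_mulVec_eq_of_mulVec_eq hl k
    rwa [← RingHom.mapMatrix_apply, ← map_pow, RingHom.mapMatrix_apply] at h2
  have h3 := norm_eigenvalue_le_of_pos_eigenvector (fun i j => (hCk i j).le) hv
    (pow_mulVec_eq_of_mulVec_eq hμ k) hz h1
  rw [norm_pow] at h3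
  exact le_of_pow_le_pow_left₀ hk.ne' hμpos.le h3

theorem specRad_eq {N : ℕ} {C : Matrix (Fin N) (Fin N) ℝ} {μ : ℝ} (hμ : 0 < μ)
    {v : Fin N → ℝ} (hv : v ≠ 0) (hCv : C *ᵥ v = μ • v)
    (hdom : ∀ (l : ℂ) (z : Fin N → ℂ), z ≠ 0 → C.map (algebraMap ℝ ℂ) *ᵥ z = l • z → ‖l‖ ≤ μ) :
    specRad C = μ := by
  have hmem : (μ : ℂ) ∈ spectrum ℂ (C.map (algebraMap ℝ ℂ)) := by
    refine mem_spectrum_iff_exists_mulVec_eq.2 ⟨fun i => (v i : ℂ), ?_, ?_⟩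
    · obtain ⟨i, hi⟩ := Function.ne_iff.1 hv
      exact Function.ne_iff.2 ⟨i, by simpa using hi⟩
    · funext i
      have := congrArg (fun x : ℝ => (x : ℂ)) (congrFun hCv i)
      simpa [mulVec, dotProduct] using this
  have h : spectralRadius ℂ (C.map (algebraMap ℝ ℂ)) = ENNReal.ofReal μ := by
    refine le_antisymm (iSup₂_le fun l hl => ?_) ?_
    · obtain ⟨z, hz, hzl⟩ := mem_spectrum_iff_exists_mulVec_eq.1 hl
      rw [← enorm_eq_nnnorm, ← ofReal_norm]
      exact ENNReal.ofReal_le_ofReal (hdom l z hz hzl)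
    · refine le_trans (le_of_eq ?_) (le_iSup₂ (α := ENNReal) (μ : ℂ) hmem)
      rw [← enorm_eq_nnnorm, ← ofReal_norm, Complex.norm_real, Real.norm_of_nonneg hμ.le]
  rw [specRad, h, ENNReal.toReal_ofReal hμ.le]

theorem EventuallyPositive.exists_isPositiveEigenvector {N : ℕ} (hN : 0 < N)
    {C : Matrix (Fin N) (Fin N) ℝ} (hC : EventuallyPositive C) :
    ∃ v, IsPositiveEigenvector C v := by
  obtain ⟨μ, hμ, ⟨v, hv, hCv⟩, hdom⟩ := hC.exists_dominant hN
  refine ⟨v, hv, ?_⟩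
  rwa [specRad_eq hμ (fun h => (hv ⟨0, hN⟩).ne' (congrFun h _)) hCv hdom]

theorem EventuallyPositive.eq_zero_of_specRad_lt {N : ℕ} (hN : 0 < N)
    {C : Matrix (Fin N) (Fin N) ℝ} (hC : EventuallyPositive C) {d : ℝ} (hd : specRad C < d)
    {w : Fin N → ℝ} (hw : C *ᵥ w = d • w) : w = 0 := by
  obtain ⟨μ, hμ, ⟨v, hv, hCv⟩, hdom⟩ := hC.exists_dominant hN
  rw [specRad_eq hμ (fun h => (hv ⟨0, hN⟩).ne' (congrFun h _)) hCv hdom] at hd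
  by_contra hne
  have h := hdom d (fun i => (w i : ℂ)) ?_ ?_
  · rw [Complex.norm_real] at h
    linarith [Real.le_norm_self d]
  · obtain ⟨i, hi⟩ := Function.ne_iff.1 hne
    exact Function.ne_iff.2 ⟨i, by simpa using hi⟩
  · funext i
    have := congrArg (fun x : ℝ => (x : ℂ)) (congrFun hw i)
    simpa [mulVec, dotProduct] using this

theorem EventuallyPositive.exists_eq_smul {N : ℕ} (hN : 0 < N)
    {C : Matrix (Fin N) (Fin N) ℝ} (hC : EventuallyPositive C) {v w : Fin N → ℝ}
    (hv : IsPositiveEigenvector C v) (hw : C *ᵥ w = specRad C • w) : ∃ s : ℝ, w = s • v := by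
  have : Nonempty (Fin N) := ⟨⟨0, hN⟩⟩
  obtain ⟨k, -, hpos⟩ := hC
  exact exists_eq_smul_of_pos (hpos k le_rfl) hv.1 (pow_mulVec_eq_of_mulVec_eq hv.2 k)
    (pow_mulVec_eq_of_mulVec_eq hw k)

end OpinionDynamics

/-! ### Scalar differential inequalities -/

theorem pos_of_abs_deriv_le_mul_abs_self {u u' : ℝ → ℝ} {K T : ℝ}
    (hu : ContinuousOn u (Set.Icc 0 T))
    (hu' : ∀ t ∈ Set.Ico 0 T, HasDerivWithinAt u (u' t) (Set.Ici t) t)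
    (hbound : ∀ t ∈ Set.Ico 0 T, |u' t| ≤ K * |u t|) (h0 : 0 < u 0) {t : ℝ}
    (ht : t ∈ Set.Icc 0 T) : 0 < u t := by
  -- `u 0 * exp (-(K + 1) t)` is a strict lower barrier
  have hB : ∀ s : ℝ, HasDerivAt (fun s => -(u 0 * Real.exp (-(K + 1) * s)))
      ((K + 1) * (u 0 * Real.exp (-(K + 1) * s))) s := fun s => by
    have h := ((((hasDerivAt_id s).const_mul (-(K + 1))).exp).const_mul (u 0)).neg
    refine h.congr_deriv ?_
    simp only [id, mul_one]
    ring
  have h := image_le_of_deriv_right_lt_deriv_boundary' (f := fun s => -u s)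
    (f' := fun s => -u' s) hu.neg (fun s hs => (hu' s hs).neg)
    (B := fun s => -(u 0 * Real.exp (-(K + 1) * s)))
    (B' := fun s => (K + 1) * (u 0 * Real.exp (-(K + 1) * s))) (by simp)
    (fun s _ => (hB s).continuousAt.continuousWithinAt) (fun s _ => (hB s).hasDerivWithinAt)
    (fun s hs heq => ?_) ht
  · have : 0 < u 0 * Real.exp (-(K + 1) * t) := by positivity
    linarith
  · have hpos : 0 < u 0 * Real.exp (-(K + 1) * s) := by positivity
    have h1 := hbound s hs
    rw [← neg_inj.1 heq] at hpos ⊢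
    rw [abs_of_pos hpos] at h1
    linarith [neg_abs_le (u' s)]

/-- If `f` decreases at rate at least `δ` wherever it is at least `M`, then it is eventually at
most `M`. -/
theorem eventually_le_of_deriv_le_neg {f f' : ℝ → ℝ} {M δ : ℝ} (hδ : 0 < δ)
    (hf : ContinuousOn f (Set.Ici 0))
    (hf' : ∀ t, 0 ≤ t → HasDerivWithinAt f (f' t) (Set.Ici t) t)
    (hM : ∀ t, 0 ≤ t → M ≤ f t → f' t ≤ -δ) : ∀ᶠ t in Filter.atTop, f t ≤ M := by
  set L := max (f 0) M with hL
  have hLM : 0 ≤ L - M := sub_nonneg.2 (le_max_right _ _)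
  set T := (L - M) / (δ / 2) with hT
  have hT0 : 0 ≤ T := by positivity
  have hTM : f T ≤ M := by
    have h := image_le_of_deriv_right_lt_deriv_boundary' (f := f) (f' := f') (a := 0) (b := T)
      (hf.mono Set.Icc_subset_Ici_self) (fun t ht => hf' t ht.1)
      (B := fun t => L - δ / 2 * t) (B' := fun _ => -(δ / 2)) (by simp [hL])
      (by fun_prop)
      (fun t _ => by
        simpa using (((hasDerivAt_id t).const_mul (δ / 2)).const_sub L).hasDerivWithinAt)
      (fun t ht heq => ?_) ⟨hT0, le_rfl⟩
    · refine h.trans_eq ?_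
      rw [hT]
      field_simp
      ring
    · have h1 : δ / 2 * t ≤ L - M := by
        have := (le_div_iff₀ (by positivity : 0 < δ / 2)).1 ht.2.le
        linarith
      have := hM t ht.1 (by rw [heq]; linarith)
      linarith
  refine Filter.eventually_atTop.2 ⟨T, fun t ht => ?_⟩
  exact image_le_of_deriv_right_lt_deriv_boundary' (f := f) (f' := f') (a := T) (b := t)
    (hf.mono fun s hs => hT0.trans hs.1) (fun s hs => hf' s (hT0.trans hs.1))
    (B := fun _ => M) (B' := fun _ => 0) hTM continuousOn_const
    (fun s _ => hasDerivWithinAt_const _ _ _)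
    (fun s hs heq => (hM s (hT0.trans hs.1) heq.ge).trans_lt (neg_neg_of_pos hδ)) ⟨ht, le_rfl⟩

/-- The dissipation rate of a nonnegative function is arbitrarily small at arbitrarily late
times. -/
theorem frequently_lt_of_deriv_le_neg {f f' q : ℝ → ℝ} (hf : ContinuousOn f (Set.Ici 0))
    (hf' : ∀ t, 0 ≤ t → HasDerivWithinAt f (f' t) (Set.Ici t) t)
    (h0 : ∀ t, 0 ≤ t → 0 ≤ f t) (hq : ∀ t, 0 ≤ t → f' t ≤ -q t) {δ : ℝ} (hδ : 0 < δ) (T : ℝ) :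
    ∃ t, T ≤ t ∧ 0 ≤ t ∧ q t < δ := by
  by_contra! hcon
  set S := max T 0 with hS
  have hS0 : 0 ≤ S := le_max_right _ _
  set t := S + (f S + 1) / δ with ht
  have hfS := h0 S hS0
  have hSt : S ≤ t := le_add_of_nonneg_right (by positivity)
  have h := image_le_of_deriv_right_le_deriv_boundary (f := f) (f' := f') (a := S) (b := t)
    (hf.mono fun s hs => hS0.trans hs.1) (fun s hs => hf' s (hS0.trans hs.1))
    (B := fun s => f S - δ * (s - S)) (B' := fun _ => -δ) (by simp)
    (by fun_prop)
    (fun s _ => by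
      simpa using
        ((((hasDerivAt_id s).sub_const S).const_mul δ).const_sub (f S)).hasDerivWithinAt)
    (fun s hs => (hq s (hS0.trans hs.1)).trans
      (neg_le_neg (hcon s ((le_max_left _ _).trans hs.1) (hS0.trans hs.1)))) ⟨hSt, le_rfl⟩
  have h1 : δ * (t - S) = f S + 1 := by
    rw [ht]
    field_simp
    ring
  linarith [h0 t (hS0.trans hSt)]

/-! ### The function `s - 1 - log s` -/

/-- The nonnegative function `s - 1 - log s` on `(0, ∞)`, which vanishes only at `1` and tends to
infinity at both ends. -/
noncomputable def logGap (s : ℝ) : ℝ := s - 1 - Real.log s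

theorem sqrt_sub_one_sq_le_logGap {s : ℝ} (hs : 0 < s) : (√s - 1) ^ 2 ≤ logGap s := by
  have h1 : Real.log s = 2 * Real.log √s := by rw [Real.log_sqrt hs.le]; ring
  have h2 := Real.log_le_sub_one_of_pos (Real.sqrt_pos.2 hs)
  have h3 := Real.sq_sqrt hs.le
  rw [logGap, h1]
  nlinarith

theorem logGap_nonneg {s : ℝ} (hs : 0 < s) : 0 ≤ logGap s :=
  (sq_nonneg _).trans (sqrt_sub_one_sq_le_logGap hs)

theorem le_of_logGap_le {s L : ℝ} (hs : 0 < s) (h : logGap s ≤ L) : s ≤ 2 * (L + 1) := by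
  have h1 := Real.log_le_sub_one_of_pos (half_pos hs)
  have h2 := Real.log_le_sub_one_of_pos (zero_lt_two (α := ℝ))
  rw [Real.log_div hs.ne' two_ne_zero] at h1
  rw [logGap] at h
  linarith

theorem exp_neg_le_of_logGap_le {s L : ℝ} (hs : 0 < s) (h : logGap s ≤ L) :
    Real.exp (-(L + 1)) ≤ s := by
  rw [← Real.le_log_iff_exp_le hs]
  rw [logGap] at h
  linarith

theorem tendsto_one_of_tendsto_logGap {β : Type*} {l : Filter β} {s : β → ℝ}
    (hs : ∀ᶠ b in l, 0 < s b) (h : Filter.Tendsto (fun b => logGap (s b)) l (nhds 0)) :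
    Filter.Tendsto s l (nhds 1) := by
  have h1 : Filter.Tendsto (fun b => (√(s b) - 1) ^ 2) l (nhds 0) :=
    tendsto_of_tendsto_of_tendsto_of_le_of_le' tendsto_const_nhds h
      (Filter.Eventually.of_forall fun b => sq_nonneg _)
      (hs.mono fun b hb => sqrt_sub_one_sq_le_logGap hb)
  have h2 : Filter.Tendsto (fun b => √(s b) - 1) l (nhds 0) := by
    have := h1.sqrt
    simp only [Real.sqrt_sq_eq_abs, Real.sqrt_zero] at this
    exact tendsto_zero_iff_abs_tendsto_zero _ |>.2 this
  have h3 : Filter.Tendsto (fun b => (√(s b) - 1 + 1) ^ 2) l (nhds ((0 + 1) ^ 2)) :=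
    (h2.add_const 1).pow 2
  rw [zero_add, one_pow] at h3
  refine h3.congr' (hs.mono fun b hb => ?_)
  rw [sub_add_cancel, Real.sq_sqrt hb.le]

namespace OpinionDynamics

open Matrix

/-! ### The vector field and its symmetries -/

/-- The vector field `x ↦ diag(x)² E x` of the stubborn neutrals dynamics. -/
def neutralsField {N : ℕ} (E : Matrix (Fin N) (Fin N) ℝ) (x : Fin N → ℝ) : Fin N → ℝ :=
  (diagonal x) ^ 2 *ᵥ (E *ᵥ x)

theorem neutralsField_apply {N : ℕ} (E : Matrix (Fin N) (Fin N) ℝ) (x : Fin N → ℝ) (i : Fin N) :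
    neutralsField E x i = x i ^ 2 * (E *ᵥ x) i := by
  rw [neutralsField, diagonal_pow, mulVec_diagonal, Pi.pow_apply]

theorem isStubbornNeutralsSolution_iff {N : ℕ} {E : Matrix (Fin N) (Fin N) ℝ}
    {x : ℝ → Fin N → ℝ} :
    IsStubbornNeutralsSolution E x ↔
      IsIntegralCurveOn x (fun _ => neutralsField E) (Set.Ici 0) :=
  Iff.rfl

theorem neutralsField_smul {N : ℕ} (E : Matrix (Fin N) (Fin N) ℝ) (a : ℝ) (x : Fin N → ℝ) :
    neutralsField E (a • x) = a ^ 3 • neutralsField E x := by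
  funext i
  simp only [neutralsField_apply, mulVec_smul, Pi.smul_apply, smul_eq_mul]
  ring

theorem locallyLipschitz_neutralsField {N : ℕ} (E : Matrix (Fin N) (Fin N) ℝ) :
    LocallyLipschitz (neutralsField E) := by
  refine ContDiff.locallyLipschitz (𝕂 := ℝ) (contDiff_pi.2 fun i => ?_)
  simp only [neutralsField_apply, mulVec, dotProduct]
  fun_prop

theorem isIntegralCurveOn_neg {N : ℕ} {E : Matrix (Fin N) (Fin N) ℝ} {x : ℝ → Fin N → ℝ}
    {s : Set ℝ} (hx : IsIntegralCurveOn x (fun _ => neutralsField E) s) :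
    IsIntegralCurveOn (fun t => -x t) (fun _ => neutralsField E) s := by
  intro t ht
  have h := neutralsField_smul E (-1) (x t)
  rw [neg_one_smul] at h
  refine (hx t ht).neg.congr_deriv ?_
  simp [h, Odd.neg_one_pow (by decide : Odd 3)]

/-- The field is homogeneous of degree three, which gives the parabolic rescaling of solutions. -/
theorem isIntegralCurveOn_rescale {N : ℕ} {E : Matrix (Fin N) (Fin N) ℝ} {x : ℝ → Fin N → ℝ}
    (hx : IsIntegralCurveOn x (fun _ => neutralsField E) (Set.Ici 0)) (a : ℝ) :
    IsIntegralCurveOn (fun t => a • x (a ^ 2 * t)) (fun _ => neutralsField E) (Set.Ici 0) := by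
  intro t ht
  have ht' : 0 ≤ t := ht
  have hmaps : Set.MapsTo (fun s : ℝ => a ^ 2 * s) (Set.Ici 0) (Set.Ici 0) := fun s hs =>
    mul_nonneg (sq_nonneg a) hs
  have h1 : HasDerivWithinAt (fun s : ℝ => a ^ 2 * s) (a ^ 2) (Set.Ici 0) t := by
    simpa using ((hasDerivAt_id t).const_mul (a ^ 2)).hasDerivWithinAt
  have h2 := ((hx (a ^ 2 * t) (hmaps ht)).scomp t h1 hmaps).const_smul a
  refine h2.congr_deriv ?_
  simp only [neutralsField_smul, smul_smul]
  congr 1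
  ring

theorem hasDerivWithinAt_apply {N : ℕ} {E : Matrix (Fin N) (Fin N) ℝ} {x : ℝ → Fin N → ℝ}
    {s : Set ℝ} {t : ℝ} (hx : HasDerivWithinAt x (neutralsField E (x t)) s t) (i : Fin N) :
    HasDerivWithinAt (fun t => x t i) (x t i ^ 2 * (E *ᵥ x t) i) s t := by
  rw [← neutralsField_apply]
  exact hasDerivWithinAt_pi.1 hx i

/-! ### Invariance of the signs of the coordinates -/

theorem exists_abs_deriv_apply_le {N : ℕ} {E : Matrix (Fin N) (Fin N) ℝ} {x : ℝ → Fin N → ℝ}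
    {T : ℝ} (hx : IsIntegralCurveOn x (fun _ => neutralsField E) (Set.Icc 0 T)) (i : Fin N) :
    ∃ K, ∀ t ∈ Set.Icc 0 T, |x t i ^ 2 * (E *ᵥ x t) i| ≤ K * |x t i| := by
  have hc : ContinuousOn x (Set.Icc 0 T) := fun t ht => (hx t ht).continuousWithinAt
  have hc' : ContinuousOn (fun t => x t i * (E *ᵥ x t) i) (Set.Icc 0 T) := by
    have : Continuous fun y : Fin N → ℝ => y i * (E *ᵥ y) i := by
      simp only [mulVec, dotProduct]
      fun_prop
    exact this.comp_continuousOn hc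
  obtain ⟨K, hK⟩ := isCompact_Icc.exists_bound_of_continuousOn hc'
  refine ⟨K, fun t ht => ?_⟩
  have h : x t i ^ 2 * (E *ᵥ x t) i = (x t i * (E *ᵥ x t) i) * x t i := by ring
  rw [h, abs_mul]
  exact mul_le_mul_of_nonneg_right (hK t ht) (abs_nonneg _)

theorem apply_pos_of_pos {N : ℕ} {E : Matrix (Fin N) (Fin N) ℝ} {x : ℝ → Fin N → ℝ}
    {T : ℝ} (hx : IsIntegralCurveOn x (fun _ => neutralsField E) (Set.Icc 0 T)) {i : Fin N}
    (h0 : 0 < x 0 i) {t : ℝ} (ht : t ∈ Set.Icc 0 T) : 0 < x t i := by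
  obtain ⟨K, hK⟩ := exists_abs_deriv_apply_le hx i
  exact pos_of_abs_deriv_le_mul_abs_self
    (fun s hs => (hasDerivWithinAt_apply (hx s hs) i).continuousWithinAt)
    (fun s hs => hasDerivWithinAt_apply (hx.hasDerivWithinAt_Ici hs) i)
    (fun s hs => hK s (Set.Ico_subset_Icc_self hs)) h0 ht

theorem apply_nonneg_of_nonneg {N : ℕ} {E : Matrix (Fin N) (Fin N) ℝ} {x : ℝ → Fin N → ℝ}
    {T : ℝ} (hx : IsIntegralCurveOn x (fun _ => neutralsField E) (Set.Icc 0 T)) {i : Fin N}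
    (h0 : 0 ≤ x 0 i) {t : ℝ} (ht : t ∈ Set.Icc 0 T) : 0 ≤ x t i := by
  rcases h0.eq_or_lt with h0 | h0
  · obtain ⟨K, hK⟩ := exists_abs_deriv_apply_le hx i
    exact (eq_zero_of_abs_deriv_le_mul_abs_self_of_eq_zero_right
      (fun s hs => (hasDerivWithinAt_apply (hx s hs) i).continuousWithinAt)
      (fun s hs => hasDerivWithinAt_apply (hx.hasDerivWithinAt_Ici hs) i) h0.symm
      (fun s hs => hK s (Set.Ico_subset_Icc_self hs)) t ht).ge
  · exact (apply_pos_of_pos hx h0 ht).le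

theorem apply_nonpos_of_nonpos {N : ℕ} {E : Matrix (Fin N) (Fin N) ℝ} {x : ℝ → Fin N → ℝ}
    {T : ℝ} (hx : IsIntegralCurveOn x (fun _ => neutralsField E) (Set.Icc 0 T)) {i : Fin N}
    (h0 : x 0 i ≤ 0) {t : ℝ} (ht : t ∈ Set.Icc 0 T) : x t i ≤ 0 :=
  neg_nonneg.1 (apply_nonneg_of_nonneg (isIntegralCurveOn_neg hx) (neg_nonneg.2 h0) ht)

/-! ### The dissipation form -/

/-- The quadratic form `-xᵀ Γ E x` with `Γ = diag(γ)`. -/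
def dissipation {N : ℕ} (γ : Fin N → ℝ) (E : Matrix (Fin N) (Fin N) ℝ) (x : Fin N → ℝ) : ℝ :=
  -∑ i, γ i * x i * (E *ᵥ x) i

theorem continuous_dissipation {N : ℕ} (γ : Fin N → ℝ) (E : Matrix (Fin N) (Fin N) ℝ) :
    Continuous (dissipation γ E) := by
  unfold dissipation mulVec dotProduct
  fun_prop

theorem dissipation_smul {N : ℕ} (γ : Fin N → ℝ) (E : Matrix (Fin N) (Fin N) ℝ) (a : ℝ)
    (x : Fin N → ℝ) : dissipation γ E (a • x) = a ^ 2 * dissipation γ E x := by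
  simp only [dissipation, mulVec_smul, Pi.smul_apply, smul_eq_mul, mul_neg, Finset.mul_sum]
  congr 1
  refine Finset.sum_congr rfl fun i _ => ?_
  ring

theorem dissipation_eq_dotProduct {N : ℕ} (γ : Fin N → ℝ) (E : Matrix (Fin N) (Fin N) ℝ)
    (x : Fin N → ℝ) : dissipation γ E x = x ⬝ᵥ (-symPart (diagonal γ * E)) *ᵥ x := by
  have h1 : x ⬝ᵥ (diagonal γ * E) *ᵥ x = ∑ i, γ i * x i * (E *ᵥ x) i := by
    rw [← mulVec_mulVec, dotProduct]
    refine Finset.sum_congr rfl fun i _ => ?_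
    rw [mulVec_diagonal]
    ring
  have h2 : x ⬝ᵥ (diagonal γ * E)ᵀ *ᵥ x = x ⬝ᵥ (diagonal γ * E) *ᵥ x := by
    rw [mulVec_transpose, dotProduct_comm, ← dotProduct_mulVec]
  rw [dissipation, symPart, neg_mulVec, dotProduct_neg, smul_mulVec, dotProduct_smul, add_mulVec,
    dotProduct_add, h2, h1, smul_eq_mul]
  ring

theorem dissipation_nonneg {N : ℕ} {γ : Fin N → ℝ} {E : Matrix (Fin N) (Fin N) ℝ}
    (hH : (-symPart (diagonal γ * E)).PosSemidef) (x : Fin N → ℝ) : 0 ≤ dissipation γ E x := by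
  rw [dissipation_eq_dotProduct]
  simpa using hH.dotProduct_mulVec_nonneg x

/-- For semidefinite `H(Γ E)` the kernel of `E` is contained in that of `H(Γ E)`; equality of the
ranks makes the kernels equal, so that the dissipation form vanishes only on the kernel of `E`. -/
theorem mulVec_eq_zero_of_dissipation_eq_zero {N : ℕ} {γ : Fin N → ℝ}
    {E : Matrix (Fin N) (Fin N) ℝ} (hH : (-symPart (diagonal γ * E)).PosSemidef)
    (hrank : (symPart (diagonal γ * E)).rank = E.rank) {x : Fin N → ℝ}
    (hx : dissipation γ E x = 0) : E *ᵥ x = 0 := by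
  have hker : ∀ y, dissipation γ E y = 0 → symPart (diagonal γ * E) *ᵥ y = 0 := by
    intro y hy
    rw [dissipation_eq_dotProduct] at hy
    have h := (hH.dotProduct_mulVec_zero_iff y).1 (by simpa using hy)
    rwa [neg_mulVec, neg_eq_zero] at h
  have hle : LinearMap.ker E.mulVecLin ≤ LinearMap.ker (symPart (diagonal γ * E)).mulVecLin := by
    intro y hy
    rw [LinearMap.mem_ker, mulVecLin_apply] at hy ⊢
    refine hker y ?_
    simp [dissipation, hy]
  have heq : LinearMap.ker E.mulVecLin = LinearMap.ker (symPart (diagonal γ * E)).mulVecLin := by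
    refine Submodule.eq_of_le_of_finrank_eq hle ?_
    have h1 := LinearMap.finrank_range_add_finrank_ker E.mulVecLin
    have h2 := LinearMap.finrank_range_add_finrank_ker (symPart (diagonal γ * E)).mulVecLin
    rw [Matrix.rank, Matrix.rank] at hrank
    omega
  have h := hker x hx
  rw [← mulVecLin_apply, ← LinearMap.mem_ker, ← heq, LinearMap.mem_ker, mulVecLin_apply] at h
  exact h

/-- A form that is positive on a closed cone minus the origin dominates the squared norm there. -/
theorem exists_norm_sq_le_dissipation {N : ℕ} {γ : Fin N → ℝ} {E : Matrix (Fin N) (Fin N) ℝ}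
    {K : Set (Fin N → ℝ)} (hK : IsClosed K) (hcone : ∀ a : ℝ, 0 ≤ a → ∀ x ∈ K, a • x ∈ K)
    (hpos : ∀ x ∈ K, x ≠ 0 → 0 < dissipation γ E x) :
    ∃ c, 0 < c ∧ ∀ x ∈ K, c * ‖x‖ ^ 2 ≤ dissipation γ E x := by
  have hcomp : IsCompact (Metric.sphere (0 : Fin N → ℝ) 1 ∩ K) :=
    (isCompact_sphere _ _).inter_right hK
  obtain ⟨c, hc, hle⟩ : ∃ c, 0 < c ∧
      ∀ x ∈ Metric.sphere (0 : Fin N → ℝ) 1 ∩ K, c ≤ dissipation γ E x := by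
    rcases (Metric.sphere (0 : Fin N → ℝ) 1 ∩ K).eq_empty_or_nonempty with h | h
    · exact ⟨1, one_pos, by simp [h]⟩
    · obtain ⟨z, hz, hmin⟩ :=
        hcomp.exists_isMinOn h (continuous_dissipation γ E).continuousOn
      exact ⟨_, hpos z hz.2 (ne_zero_of_mem_unit_sphere ⟨z, hz.1⟩), fun x hx => hmin hx⟩
  refine ⟨c, hc, fun x hx => ?_⟩
  rcases eq_or_ne x 0 with rfl | hx0
  · simp [dissipation]
  · have hn : 0 < ‖x‖ := norm_pos_iff.2 hx0
    have h := hle (‖x‖⁻¹ • x) ⟨by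
      rw [mem_sphere_zero_iff_norm, norm_smul, norm_inv, norm_norm, inv_mul_cancel₀ hn.ne'],
      hcone _ (inv_nonneg.2 hn.le) x hx⟩
    rw [dissipation_smul, inv_pow, ← div_eq_inv_mul, le_div_iff₀ (by positivity)] at h
    exact h

theorem abs_sum_mul_mulVec_le {N : ℕ} {γ : Fin N → ℝ} (hγ : ∀ i, 0 < γ i)
    (E : Matrix (Fin N) (Fin N) ℝ) (y z : Fin N → ℝ) :
    |∑ i, γ i * y i * (E *ᵥ z) i| ≤ (∑ i, ∑ j, γ i * |E i j|) * ‖y‖ * ‖z‖ := by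
  rw [Finset.sum_mul, Finset.sum_mul]
  refine (Finset.abs_sum_le_sum_abs _ _).trans (Finset.sum_le_sum fun i _ => ?_)
  have h1 : |(E *ᵥ z) i| ≤ (∑ j, |E i j|) * ‖z‖ := by
    rw [mulVec, dotProduct, Finset.sum_mul]
    refine (Finset.abs_sum_le_sum_abs _ _).trans (Finset.sum_le_sum fun j _ => ?_)
    rw [abs_mul]
    exact mul_le_mul_of_nonneg_left (norm_le_pi_norm z j) (abs_nonneg _)
  rw [abs_mul, abs_mul, abs_of_pos (hγ i), ← Finset.mul_sum]
  have h2 : |y i| ≤ ‖y‖ := norm_le_pi_norm y i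
  calc γ i * |y i| * |(E *ᵥ z) i| ≤ γ i * ‖y‖ * ((∑ j, |E i j|) * ‖z‖) := by
        have := (hγ i).le
        gcongr
    _ = γ i * ∑ j, |E i j| * ‖y‖ * ‖z‖ := by
        simp only [Finset.mul_sum, Finset.sum_mul]
        refine Finset.sum_congr rfl fun j _ => ?_
        ring
    _ = _ := by
        simp only [Finset.mul_sum, Finset.sum_mul]
        refine Finset.sum_congr rfl fun j _ => ?_
        ring

/-! ### Decay in a cone on which the dissipation form is definite -/

/-- The proper function `½ ∑ γᵢ log (1 + xᵢ²)`. -/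
noncomputable def logEnergy {N : ℕ} (γ x : Fin N → ℝ) : ℝ :=
  ∑ i, γ i * (1 / 2 * Real.log (1 + x i ^ 2))

/-- The vector with coordinates `xᵢ³ / (1 + xᵢ²)`: along solutions, `logEnergy` has derivative
`∑ γᵢ (damp x)ᵢ (E x)ᵢ`. It has the signs of `x` and stays within distance `1` of `x`. -/
noncomputable def damp {N : ℕ} (x : Fin N → ℝ) : Fin N → ℝ :=
  fun i => x i ^ 2 / (1 + x i ^ 2) * x i

theorem norm_sub_damp_le {N : ℕ} (x : Fin N → ℝ) : ‖x - damp x‖ ≤ 1 := by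
  refine (pi_norm_le_iff_of_nonneg zero_le_one).2 fun i => ?_
  have h : (x - damp x) i = x i / (1 + x i ^ 2) := by
    simp only [Pi.sub_apply, damp]
    field_simp
    ring
  rw [h, Real.norm_eq_abs, abs_div, abs_of_pos (by positivity : 0 < 1 + x i ^ 2),
    div_le_one (by positivity)]
  nlinarith [sq_abs (x i), sq_nonneg (|x i| - 1)]

theorem hasDerivWithinAt_logEnergy {N : ℕ} {γ : Fin N → ℝ} {E : Matrix (Fin N) (Fin N) ℝ}
    {x : ℝ → Fin N → ℝ} {s : Set ℝ} {t : ℝ}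
    (hx : HasDerivWithinAt x (neutralsField E (x t)) s t) :
    HasDerivWithinAt (fun t => logEnergy γ (x t)) (∑ i, γ i * damp (x t) i * (E *ᵥ x t) i) s t := by
  refine HasDerivWithinAt.fun_sum fun i _ => ?_
  have h1 := ((hasDerivWithinAt_apply hx i).pow 2).const_add 1
  have hp : 1 + x t i ^ 2 ≠ 0 := by positivity
  have h2 := ((h1.log hp).const_mul (1 / 2)).const_mul (γ i)
  refine h2.congr_deriv ?_
  simp only [damp, Pi.pow_apply, Nat.cast_ofNat, Nat.add_one_sub_one, pow_one]
  field_simp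

theorem norm_le_of_logEnergy_le {N : ℕ} {γ : Fin N → ℝ} (hγ : ∀ i, 0 < γ i) {x : Fin N → ℝ}
    {L : ℝ} (h : logEnergy γ x ≤ L) : ‖x‖ ≤ 1 + ∑ i, Real.exp (2 * L / γ i) := by
  have hS : 0 ≤ ∑ i, Real.exp (2 * L / γ i) := Finset.sum_nonneg fun i _ => (Real.exp_pos _).le
  refine (pi_norm_le_iff_of_nonneg (by linarith)).2 fun i => ?_
  have h1 : γ i * (1 / 2 * Real.log (1 + x i ^ 2)) ≤ L := by
    refine le_trans ?_ h
    refine Finset.single_le_sum (f := fun i => γ i * (1 / 2 * Real.log (1 + x i ^ 2)))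
      (fun j _ => ?_) (Finset.mem_univ i)
    have := Real.log_nonneg (by nlinarith [sq_nonneg (x j)] : 1 ≤ 1 + x j ^ 2)
    have := (hγ j).le
    positivity
  have h2 : Real.log (1 + x i ^ 2) ≤ 2 * L / γ i := by
    rw [le_div_iff₀ (hγ i)]
    linarith
  rw [Real.log_le_iff_le_exp (by positivity)] at h2
  have h3 := Finset.single_le_sum (f := fun i => Real.exp (2 * L / γ i))
    (fun j _ => (Real.exp_pos _).le) (Finset.mem_univ i)
  rw [Real.norm_eq_abs]
  nlinarith [sq_abs (x i), sq_nonneg (|x i| - 1), abs_nonneg (x i)]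

theorem logEnergy_le_of_norm_le {N : ℕ} {γ : Fin N → ℝ} (hγ : ∀ i, 0 < γ i) {x : Fin N → ℝ}
    {R : ℝ} (h : ‖x‖ ≤ R) : logEnergy γ x ≤ (∑ i, γ i) * (1 / 2 * Real.log (1 + R ^ 2)) := by
  rw [Finset.sum_mul]
  refine Finset.sum_le_sum fun i _ => ?_
  have h1 : x i ^ 2 ≤ R ^ 2 := sq_le_sq' (abs_le.1 ((norm_le_pi_norm x i).trans h)).1
    (abs_le.1 ((norm_le_pi_norm x i).trans h)).2
  have := (hγ i).le
  gcongr

/-- A closed set of vectors that is invariant under nonnegative diagonal scalings, such as the set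
of vectors with prescribed weak signs of some coordinates. -/
structure IsSignCone {N : ℕ} (K : Set (Fin N → ℝ)) : Prop where
  isClosed : IsClosed K
  mul_mem : ∀ a : Fin N → ℝ, 0 ≤ a → ∀ x ∈ K, a * x ∈ K

theorem IsSignCone.smul_mem {N : ℕ} {K : Set (Fin N → ℝ)} (hK : IsSignCone K) {a : ℝ}
    (ha : 0 ≤ a) {x : Fin N → ℝ} (hx : x ∈ K) : a • x ∈ K := by
  simpa [Pi.mul_def, Pi.smul_def] using hK.mul_mem (fun _ => a) (fun _ => ha) x hx

theorem IsSignCone.damp_mem {N : ℕ} {K : Set (Fin N → ℝ)} (hK : IsSignCone K) {x : Fin N → ℝ}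
    (hx : x ∈ K) : damp x ∈ K :=
  hK.mul_mem (fun i => x i ^ 2 / (1 + x i ^ 2)) (fun i => by positivity) x hx

/-- Far from the origin of a cone on which the dissipation form is definite, `logEnergy` decreases
at a uniform rate: its derivative is `-dissipation (damp x)` up to an error that is only linear in
`damp x`. -/
theorem exists_logEnergy_deriv_le {N : ℕ} {γ : Fin N → ℝ} (hγ : ∀ i, 0 < γ i)
    {E : Matrix (Fin N) (Fin N) ℝ} {K : Set (Fin N → ℝ)} (hK : IsSignCone K)
    (hpos : ∀ x ∈ K, x ≠ 0 → 0 < dissipation γ E x) :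
    ∃ M δ : ℝ, 0 < δ ∧ ∀ x ∈ K, M ≤ logEnergy γ x →
      ∑ i, γ i * damp x i * (E *ᵥ x) i ≤ -δ := by
  rcases N.eq_zero_or_pos with rfl | hN
  · exact ⟨1, 1, one_pos, fun x _ h => by simp [logEnergy] at h; linarith⟩
  obtain ⟨c, hc, hle⟩ := exists_norm_sq_le_dissipation hK.isClosed
    (fun a ha x hx => hK.smul_mem ha hx) hpos
  set A := ∑ i, ∑ j, γ i * |E i j| with hA
  have hA0 : 0 ≤ A := Finset.sum_nonneg fun i _ => Finset.sum_nonneg fun j _ =>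
    mul_nonneg (hγ i).le (abs_nonneg _)
  set R := A / c + 1 with hR
  have hR0 : 1 ≤ R := by rw [hR]; linarith [div_nonneg hA0 hc.le]
  have hγs : 0 < ∑ i, γ i :=
    Finset.sum_pos (fun i _ => hγ i) ⟨⟨0, hN⟩, Finset.mem_univ _⟩
  refine ⟨(∑ i, γ i) * (1 / 2 * Real.log (1 + (R + 1) ^ 2)), c, hc, fun x hx hM => ?_⟩
  have hnx : R + 1 ≤ ‖x‖ := by
    by_contra! hlt
    refine absurd hM (not_le.2 ?_)
    refine (logEnergy_le_of_norm_le hγ le_rfl).trans_lt ?_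
    have : Real.log (1 + ‖x‖ ^ 2) < Real.log (1 + (R + 1) ^ 2) :=
      Real.log_lt_log (by positivity) (by gcongr)
    gcongr
  set g := damp x with hg
  have hng : R ≤ ‖g‖ := by
    have h1 := norm_sub_damp_le x
    have h2 := norm_sub_norm_le x g
    rw [← hg] at h1
    linarith
  have hsplit : ∑ i, γ i * g i * (E *ᵥ x) i =
      -dissipation γ E g + ∑ i, γ i * g i * (E *ᵥ (x - g)) i := by
    rw [dissipation, neg_neg, ← Finset.sum_add_distrib]
    refine Finset.sum_congr rfl fun i _ => ?_
    rw [mulVec_sub, Pi.sub_apply]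
    ring
  have h1 := hle g (hK.damp_mem hx)
  have h2 := (le_abs_self _).trans (abs_sum_mul_mulVec_le hγ E g (x - g))
  have h3 : A * ‖g‖ * ‖x - g‖ ≤ A * ‖g‖ :=
    mul_le_of_le_one_right (by positivity) (norm_sub_damp_le x)
  have h4 : A = c * (R - 1) := by
    rw [hR]
    field_simp
    ring
  rw [hsplit]
  rw [← hA] at h2
  -- the quadratic term wins: `-c g² + A g ≤ -c g (g - R + 1) ≤ -c`
  have h5 : c * 1 ≤ c * (‖g‖ * (‖g‖ - (R - 1))) := by
    refine mul_le_mul_of_nonneg_left ?_ hc.le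
    nlinarith
  nlinarith

/-- The a priori bound is independent of the length `T` of the interval of existence. -/
theorem exists_norm_bound_of_mem_cone {N : ℕ} {γ : Fin N → ℝ} (hγ : ∀ i, 0 < γ i)
    {E : Matrix (Fin N) (Fin N) ℝ} {K : Set (Fin N → ℝ)} (hK : IsSignCone K)
    (hpos : ∀ x ∈ K, x ≠ 0 → 0 < dissipation γ E x) (x₀ : Fin N → ℝ) :
    ∃ R : ℝ, ∀ T, 0 ≤ T → ∀ x : ℝ → Fin N → ℝ, x 0 = x₀ →
      IsIntegralCurveOn x (fun _ => neutralsField E) (Set.Icc 0 T) →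
      (∀ t ∈ Set.Icc 0 T, x t ∈ K) → ‖x T‖ ≤ R := by
  obtain ⟨M, δ, hδ, hM⟩ := exists_logEnergy_deriv_le hγ hK hpos
  refine ⟨_, fun T hT x hx0 hx hxK =>
    norm_le_of_logEnergy_le (L := max M (logEnergy γ x₀)) hγ ?_⟩
  exact image_le_of_deriv_right_lt_deriv_boundary' (f := fun t => logEnergy γ (x t))
    (fun t ht => (hasDerivWithinAt_logEnergy (hx t ht)).continuousWithinAt)
    (fun t ht => hasDerivWithinAt_logEnergy (hx.hasDerivWithinAt_Ici ht))
    (B := fun _ => max M (logEnergy γ x₀)) (B' := fun _ => 0) (by simp [hx0])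
    continuousOn_const (fun t _ => hasDerivWithinAt_const _ _ _)
    (fun t ht heq => (hM _ (hxK t (Set.Ico_subset_Icc_self ht))
      (by rw [heq]; exact le_max_left _ _)).trans_lt (neg_neg_of_pos hδ)) ⟨hT, le_rfl⟩

/-- Solutions in the cone enter a ball whose radius does not depend on the solution. As rescaled
solutions are solutions, they enter every ball around the origin. -/
theorem tendsto_zero_of_mem_cone {N : ℕ} {γ : Fin N → ℝ} (hγ : ∀ i, 0 < γ i)
    {E : Matrix (Fin N) (Fin N) ℝ} {K : Set (Fin N → ℝ)} (hK : IsSignCone K)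
    (hpos : ∀ x ∈ K, x ≠ 0 → 0 < dissipation γ E x) {x : ℝ → Fin N → ℝ}
    (hx : IsIntegralCurveOn x (fun _ => neutralsField E) (Set.Ici 0))
    (hxK : ∀ t, 0 ≤ t → x t ∈ K) : Filter.Tendsto x Filter.atTop (nhds 0) := by
  obtain ⟨M, δ, hδ, hM⟩ := exists_logEnergy_deriv_le hγ hK hpos
  set R := 1 + ∑ i, Real.exp (2 * M / γ i) with hR
  have hR0 : 0 < R := by
    have : 0 ≤ ∑ i, Real.exp (2 * M / γ i) := Finset.sum_nonneg fun i _ => (Real.exp_pos _).le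
    linarith
  have key : ∀ a : ℝ, 0 < a → ∀ᶠ t in Filter.atTop, ‖x t‖ ≤ R / a := by
    intro a ha
    have hy := isIntegralCurveOn_rescale hx a
    have h1 := eventually_le_of_deriv_le_neg
      (f := fun t => logEnergy γ (a • x (a ^ 2 * t))) (M := M) hδ
      (fun t ht => (hasDerivWithinAt_logEnergy (hy t ht)).continuousWithinAt)
      (fun t ht => (hasDerivWithinAt_logEnergy (hy t ht)).mono (Set.Ici_subset_Ici.2 ht))
      (fun t ht h => hM _ (hK.smul_mem ha.le (hxK _ (mul_nonneg (sq_nonneg a) ht))) h)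
    have h2 : Filter.Tendsto (fun t : ℝ => t / a ^ 2) Filter.atTop Filter.atTop :=
      Filter.tendsto_id.atTop_div_const (by positivity)
    filter_upwards [h2.eventually h1] with t ht
    rw [mul_div_cancel₀ _ (by positivity : a ^ 2 ≠ 0)] at ht
    have h3 := norm_le_of_logEnergy_le hγ ht
    rw [norm_smul, Real.norm_of_nonneg ha.le, ← hR] at h3
    rw [le_div_iff₀ ha]
    linarith
  rw [Metric.tendsto_nhds]
  intro ε hε
  filter_upwards [key (2 * R / ε) (by positivity)] with t ht
  rw [dist_zero_right]
  refine ht.trans_lt ?_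
  rw [div_div_eq_mul_div, div_lt_iff₀ (by positivity)]
  nlinarith

/-! ### Convergence in the positive orthant -/

/-- The relative energy `∑ γᵢ (pᵢ/xᵢ - 1 - log (pᵢ/xᵢ))` of `x` with respect to `p`, both in the
open positive orthant. -/
noncomputable def relEnergy {N : ℕ} (γ p x : Fin N → ℝ) : ℝ := ∑ i, γ i * logGap (p i / x i)

theorem relEnergy_nonneg {N : ℕ} {γ p x : Fin N → ℝ} (hγ : ∀ i, 0 < γ i) (hp : ∀ i, 0 < p i)
    (hx : ∀ i, 0 < x i) : 0 ≤ relEnergy γ p x :=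
  Finset.sum_nonneg fun i _ => mul_nonneg (hγ i).le (logGap_nonneg (div_pos (hp i) (hx i)))

theorem logGap_le_relEnergy_div {N : ℕ} {γ p x : Fin N → ℝ} (hγ : ∀ i, 0 < γ i)
    (hp : ∀ i, 0 < p i) (hx : ∀ i, 0 < x i) (i : Fin N) :
    logGap (p i / x i) ≤ relEnergy γ p x / γ i := by
  rw [le_div_iff₀ (hγ i), mul_comm]
  exact Finset.single_le_sum (f := fun i => γ i * logGap (p i / x i))
    (fun j _ => mul_nonneg (hγ j).le (logGap_nonneg (div_pos (hp j) (hx j)))) (Finset.mem_univ i)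

/-- Sublevel sets of the relative energy are contained in compact boxes of the open orthant. -/
theorem exists_Icc_of_relEnergy_le {N : ℕ} {γ p : Fin N → ℝ} (hγ : ∀ i, 0 < γ i)
    (hp : ∀ i, 0 < p i) {L : ℝ} (hL : 0 ≤ L) :
    ∃ lo hi : Fin N → ℝ, (∀ i, 0 < lo i) ∧
      ∀ x, (∀ i, 0 < x i) → relEnergy γ p x ≤ L → x ∈ Set.Icc lo hi := by
  have hLγ : ∀ i, 0 ≤ L / γ i := fun i => div_nonneg hL (hγ i).le
  refine ⟨fun i => p i / (2 * (L / γ i + 1)), fun i => p i / Real.exp (-(L / γ i + 1)),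
    fun i => div_pos (hp i) (by linarith [hLγ i]), fun x hx h => ?_⟩
  have hgap : ∀ i, logGap (p i / x i) ≤ L / γ i := fun i =>
    (logGap_le_relEnergy_div hγ hp hx i).trans (div_le_div_of_nonneg_right h (hγ i).le)
  refine ⟨fun i => ?_, fun i => ?_⟩
  · have h1 := le_of_logGap_le (div_pos (hp i) (hx i)) (hgap i)
    rw [div_le_iff₀ (hx i)] at h1
    rw [div_le_iff₀ (by linarith [hLγ i])]
    linarith
  · have h1 := exp_neg_le_of_logGap_le (div_pos (hp i) (hx i)) (hgap i)
    rw [le_div_iff₀ (hx i)] at h1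
    rw [le_div_iff₀ (Real.exp_pos _)]
    linarith

theorem hasDerivWithinAt_relEnergy {N : ℕ} {γ p : Fin N → ℝ} {E : Matrix (Fin N) (Fin N) ℝ}
    (hp : ∀ i, 0 < p i) (hEp : E *ᵥ p = 0) {x : ℝ → Fin N → ℝ} {s : Set ℝ} {t : ℝ}
    (hx : HasDerivWithinAt x (neutralsField E (x t)) s t) (hpos : ∀ i, 0 < x t i) :
    HasDerivWithinAt (fun t => relEnergy γ p (x t)) (-dissipation γ E (x t - p)) s t := by
  have hval : -dissipation γ E (x t - p) =
      ∑ i, γ i * ((x t i - p i) * (E *ᵥ x t) i) := by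
    rw [dissipation, neg_neg]
    refine Finset.sum_congr rfl fun i _ => ?_
    rw [mulVec_sub, hEp, sub_zero, Pi.sub_apply, mul_assoc]
  rw [hval]
  refine HasDerivWithinAt.fun_sum fun i _ => ?_
  have hxi := hpos i
  have hpi := hp i
  have h1 := (hasDerivWithinAt_const t s (p i)).fun_div (hasDerivWithinAt_apply hx i) hxi.ne'
  have h2 := ((h1.sub_const 1).fun_sub (h1.log (div_pos hpi hxi).ne')).const_mul (γ i)
  refine h2.congr_deriv ?_
  field_simp
  ring

theorem relEnergy_le_of_le {N : ℕ} {γ p : Fin N → ℝ} {E : Matrix (Fin N) (Fin N) ℝ}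
    (hD : ∀ y, 0 ≤ dissipation γ E y) (hp : ∀ i, 0 < p i) (hEp : E *ᵥ p = 0)
    {x : ℝ → Fin N → ℝ} {T : ℝ}
    (hx : IsIntegralCurveOn x (fun _ => neutralsField E) (Set.Icc 0 T))
    (hpos : ∀ t ∈ Set.Icc 0 T, ∀ i, 0 < x t i) {s : ℝ} (hs : s ∈ Set.Icc 0 T) :
    relEnergy γ p (x T) ≤ relEnergy γ p (x s) := by
  have hsub : Set.Icc s T ⊆ Set.Icc 0 T := Set.Icc_subset_Icc_left hs.1
  exact image_le_of_deriv_right_le_deriv_boundary (f := fun t => relEnergy γ p (x t))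
    (fun t ht => ((hasDerivWithinAt_relEnergy hp hEp (hx t (hsub ht))
      (hpos t (hsub ht))).continuousWithinAt).mono hsub)
    (fun t ht => hasDerivWithinAt_relEnergy hp hEp
      (hx.hasDerivWithinAt_Ici ⟨hs.1.trans ht.1, ht.2⟩) (hpos t (hsub (Set.Ico_subset_Icc_self ht))))
    (B := fun _ => relEnergy γ p (x s)) (B' := fun _ => 0) le_rfl
    continuousOn_const (fun t _ => hasDerivWithinAt_const _ _ _)
    (fun t _ => neg_nonpos.2 (hD _)) ⟨hs.2, le_rfl⟩

theorem exists_norm_bound_of_pos {N : ℕ} {γ v : Fin N → ℝ} (hγ : ∀ i, 0 < γ i)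
    {E : Matrix (Fin N) (Fin N) ℝ} (hD : ∀ y, 0 ≤ dissipation γ E y) (hv : ∀ i, 0 < v i)
    (hEv : E *ᵥ v = 0) {x₀ : Fin N → ℝ} (hx₀ : ∀ i, 0 < x₀ i) :
    ∃ R : ℝ, ∀ T, 0 ≤ T → ∀ x : ℝ → Fin N → ℝ, x 0 = x₀ →
      IsIntegralCurveOn x (fun _ => neutralsField E) (Set.Icc 0 T) → ‖x T‖ ≤ R := by
  obtain ⟨lo, hi, hlo, hbox⟩ := exists_Icc_of_relEnergy_le hγ hv (relEnergy_nonneg hγ hv hx₀)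
  refine ⟨‖hi‖, fun T hT x hx0 hx => ?_⟩
  have hpos : ∀ t ∈ Set.Icc 0 T, ∀ i, 0 < x t i := fun t ht i =>
    apply_pos_of_pos hx (by rw [hx0]; exact hx₀ i) ht
  have h := relEnergy_le_of_le hD hv hEv hx hpos ⟨le_rfl, hT⟩
  rw [hx0] at h
  have hmem := hbox _ (hpos T ⟨hT, le_rfl⟩) h
  refine (pi_norm_le_iff_of_nonneg (norm_nonneg _)).2 fun i => ?_
  rw [Real.norm_of_nonneg (hpos T ⟨hT, le_rfl⟩ i).le]
  exact (hmem.2 i).trans ((Real.le_norm_self _).trans (norm_le_pi_norm hi i))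

/-- A positive solution has an accumulation point `p` at which the dissipation vanishes. Then `p` is
an equilibrium, the energy relative to `p` is nonincreasing too, and it tends to zero along a
sequence of times, hence altogether. -/
theorem exists_tendsto_of_pos {N : ℕ} {γ v : Fin N → ℝ} (hγ : ∀ i, 0 < γ i)
    {E : Matrix (Fin N) (Fin N) ℝ} (hD : ∀ y, 0 ≤ dissipation γ E y)
    (hker : ∀ y, dissipation γ E y = 0 → E *ᵥ y = 0) (hv : ∀ i, 0 < v i)
    (hEv : E *ᵥ v = 0) {x : ℝ → Fin N → ℝ}
    (hx : IsIntegralCurveOn x (fun _ => neutralsField E) (Set.Ici 0)) (hx0 : ∀ i, 0 < x 0 i) :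
    ∃ p : Fin N → ℝ, (∀ i, 0 < p i) ∧ E *ᵥ p = 0 ∧
      Filter.Tendsto x Filter.atTop (nhds p) := by
  have hxT : ∀ T, IsIntegralCurveOn x (fun _ => neutralsField E) (Set.Icc 0 T) := fun T =>
    hx.mono Set.Icc_subset_Ici_self
  have hpos : ∀ t, 0 ≤ t → ∀ i, 0 < x t i := fun t ht i =>
    apply_pos_of_pos (hxT t) (hx0 i) ⟨ht, le_rfl⟩
  have hanti : ∀ p : Fin N → ℝ, (∀ i, 0 < p i) → E *ᵥ p = 0 → ∀ s t, 0 ≤ s → s ≤ t →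
      relEnergy γ p (x t) ≤ relEnergy γ p (x s) := fun p hp hEp s t hs hst =>
    relEnergy_le_of_le hD hp hEp (hxT t) (fun u hu => hpos u hu.1) ⟨hs, hst⟩
  obtain ⟨lo, hi, hlo, hbox⟩ := exists_Icc_of_relEnergy_le hγ hv (relEnergy_nonneg hγ hv hx0)
  have hmem : ∀ t, 0 ≤ t → x t ∈ Set.Icc lo hi := fun t ht =>
    hbox _ (hpos t ht) (hanti v hv hEv 0 t le_rfl ht)
  choose τ hτ hτ0 hτq using fun n : ℕ => frequently_lt_of_deriv_le_neg
    (f := fun t => relEnergy γ v (x t)) (q := fun t => dissipation γ E (x t - v))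
    (fun t ht => (hasDerivWithinAt_relEnergy hv hEv (hx t ht) (hpos t ht)).continuousWithinAt)
    (fun t ht => (hasDerivWithinAt_relEnergy hv hEv (hx t ht) (hpos t ht)).mono
      (Set.Ici_subset_Ici.2 ht))
    (fun t ht => relEnergy_nonneg hγ hv (hpos t ht)) (fun t ht => le_rfl)
    (Nat.one_div_pos_of_nat (α := ℝ) (n := n)) (n : ℝ)
  obtain ⟨p, hpmem, φ, hφ, hlim⟩ :=
    (isCompact_Icc (a := lo) (b := hi)).tendsto_subseq fun n => hmem (τ n) (hτ0 n)
  have hp : ∀ i, 0 < p i := fun i => (hlo i).trans_le (hpmem.1 i)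
  have hEp : E *ᵥ p = 0 := by
    have h1 : Filter.Tendsto (fun n => dissipation γ E (x (τ (φ n)) - v)) Filter.atTop
        (nhds (dissipation γ E (p - v))) :=
      ((continuous_dissipation γ E).tendsto _).comp (hlim.sub_const v)
    have h2 : Filter.Tendsto (fun n => 1 / ((φ n : ℝ) + 1)) Filter.atTop (nhds 0) :=
      tendsto_one_div_add_atTop_nhds_zero_nat.comp hφ.tendsto_atTop
    have h3 := hker _ (le_antisymm (le_of_tendsto_of_tendsto' h1 h2 fun n => (hτq (φ n)).le) (hD _))
    rwa [mulVec_sub, hEv, sub_zero] at h3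
  refine ⟨p, hp, hEp, ?_⟩
  have hsub : Filter.Tendsto (fun n => relEnergy γ p (x (τ (φ n)))) Filter.atTop (nhds 0) := by
    have h1 : ContinuousAt (relEnergy γ p) p := by
      refine tendsto_finsetSum _ fun i _ => ?_
      have h2 : ContinuousAt (fun y : Fin N → ℝ => p i / y i) p :=
        continuousAt_const.div (continuous_apply i).continuousAt (hp i).ne'
      exact ((h2.sub_const 1).sub (h2.log (div_pos (hp i) (hp i)).ne')).const_mul (γ i)
    have h2 : relEnergy γ p p = 0 :=
      Finset.sum_eq_zero fun i _ => by rw [div_self (hp i).ne']; simp [logGap]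
    rw [← h2]
    exact h1.tendsto.comp hlim
  have hrel : Filter.Tendsto (fun t => relEnergy γ p (x t)) Filter.atTop (nhds 0) := by
    refine tendsto_order.2 ⟨fun a ha => ?_, fun a ha => ?_⟩
    · filter_upwards [Filter.eventually_ge_atTop 0] with t ht
      exact ha.trans_le (relEnergy_nonneg hγ hp (hpos t ht))
    · obtain ⟨n, hn⟩ := ((tendsto_order.1 hsub).2 a ha).exists
      filter_upwards [Filter.eventually_ge_atTop (τ (φ n))] with t ht
      exact (hanti p hp hEp _ t (hτ0 _) ht).trans_lt hn
  refine tendsto_pi_nhds.2 fun i => ?_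
  have hgap : Filter.Tendsto (fun t => logGap (p i / x t i)) Filter.atTop (nhds 0) := by
    have h1 := hrel.div_const (γ i)
    rw [zero_div] at h1
    refine tendsto_of_tendsto_of_tendsto_of_le_of_le' tendsto_const_nhds h1 ?_ ?_
    · filter_upwards [Filter.eventually_ge_atTop 0] with t ht
      exact logGap_nonneg (div_pos (hp i) (hpos t ht i))
    · filter_upwards [Filter.eventually_ge_atTop 0] with t ht
      exact logGap_le_relEnergy_div hγ hp (hpos t ht) i
  have hone := tendsto_one_of_tendsto_logGap
    ((Filter.eventually_ge_atTop 0).mono fun t ht => div_pos (hp i) (hpos t ht i)) hgap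
  have h2 := (tendsto_const_nhds (x := p i)).div hone one_ne_zero
  rw [div_one] at h2
  refine h2.congr' ?_
  filter_upwards [Filter.eventually_ge_atTop 0] with t ht
  exact div_div_cancel₀ (hp i).ne'

/-! ### Application to the dynamics -/

theorem isSignCone_univ {N : ℕ} : IsSignCone (Set.univ : Set (Fin N → ℝ)) :=
  ⟨isClosed_univ, fun _ _ _ _ => Set.mem_univ _⟩

theorem isSignCone_mixed {N : ℕ} (i j : Fin N) :
    IsSignCone {x : Fin N → ℝ | x i ≤ 0 ∧ 0 ≤ x j} where
  isClosed := (isClosed_le (continuous_apply i) continuous_const).inter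
    (isClosed_le continuous_const (continuous_apply j))
  mul_mem _ ha _ hx := ⟨mul_nonpos_of_nonneg_of_nonpos (ha i) hx.1, mul_nonneg (ha j) hx.2⟩

theorem exists_solution_of_bound {N : ℕ} {E : Matrix (Fin N) (Fin N) ℝ} {x₀ : Fin N → ℝ}
    (h : ∃ R : ℝ, ∀ T, 0 ≤ T → ∀ x : ℝ → Fin N → ℝ, x 0 = x₀ →
      IsIntegralCurveOn x (fun _ => neutralsField E) (Set.Icc 0 T) → ‖x T‖ ≤ R) :
    ∃ x : ℝ → Fin N → ℝ, IsStubbornNeutralsSolution E x ∧ x 0 = x₀ := by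
  obtain ⟨R, hR⟩ := h
  obtain ⟨x, hx0, hx⟩ := exists_isIntegralCurveOn_Ici_of_bound
    (locallyLipschitz_neutralsField E) x₀ R hR
  exact ⟨x, isStubbornNeutralsSolution_iff.2 hx, hx0⟩

theorem norm_le_one_of_tendsto_of_mem_opinionCube {N : ℕ} {x : ℝ → Fin N → ℝ} {p : Fin N → ℝ}
    (hx : Filter.Tendsto x Filter.atTop (nhds p)) (hcube : ∀ t, 0 ≤ t → x t ∈ opinionCube N) :
    ‖p‖ ≤ 1 := by
  refine le_of_tendsto hx.norm ((Filter.eventually_ge_atTop 0).mono fun t ht => ?_)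
  exact (pi_norm_le_iff_of_nonneg zero_le_one).2 fun i => abs_le.2 (hcube t ht i)

/-- The positive half of the critical case, for an arbitrary positive eigenvector. -/
theorem exists_tendsto_smul_of_pos {N : ℕ} (hN : 0 < N) {γ : Fin N → ℝ} (hγ : ∀ i, 0 < γ i)
    {C E : Matrix (Fin N) (Fin N) ℝ} (hC : EventuallyPositive C)
    (hE : ∀ y, E *ᵥ y = C *ᵥ y - specRad C • y) (hD : ∀ y, 0 ≤ dissipation γ E y)
    (hker : ∀ y, dissipation γ E y = 0 → E *ᵥ y = 0) {v : Fin N → ℝ}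
    (hv : IsPositiveEigenvector C v) {x : ℝ → Fin N → ℝ}
    (hx : IsIntegralCurveOn x (fun _ => neutralsField E) (Set.Ici 0)) (hx0 : ∀ i, 0 < x 0 i) :
    ∃ α : ℝ, 0 < α ∧ ((∀ t : ℝ, 0 ≤ t → x t ∈ opinionCube N) → α ≤ 1 / ‖v‖) ∧
      Filter.Tendsto x Filter.atTop (nhds (α • v)) := by
  have hEv : E *ᵥ v = 0 := by rw [hE, hv.2, sub_self]
  obtain ⟨p, hp, hEp, hlim⟩ := exists_tendsto_of_pos hγ hD hker hv.1 hEv hx hx0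
  rw [hE, sub_eq_zero] at hEp
  obtain ⟨α, rfl⟩ := hC.exists_eq_smul hN hv hEp
  have hα : 0 < α := pos_of_mul_pos_left (hp ⟨0, hN⟩) (hv.1 _).le
  refine ⟨α, hα, fun hcube => ?_, hlim⟩
  have h := norm_le_one_of_tendsto_of_mem_opinionCube hlim hcube
  rw [norm_smul, Real.norm_of_nonneg hα.le] at h
  have hv0 : v ≠ 0 := fun h => (hv.1 ⟨0, hN⟩).ne' (congrFun h _)
  rwa [le_div_iff₀ (norm_pos_iff.2 hv0)]

end OpinionDynamics

theorem theorem2 {N : ℕ} (hN : 0 < N)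
    (B : Matrix (Fin N) (Fin N) ℝ) (σ : Fin N → ℝ)
    -- the model: a strongly connected signed digraph without self-loops, positive forgetting factors
    (hB : ∀ i, B i i = 0) (hconn : OpinionDynamics.StronglyConnected B) (hσ : ∀ i, 0 < σ i)
    -- one of the two assumptions; in the first case `C` stands for `B` and `d` for the common `σ i`
    (C : Matrix (Fin N) (Fin N) ℝ) (d : ℝ)
    (hA : (OpinionDynamics.Assumption1 B σ ∧ C = B ∧ ∀ i, σ i = d) ∨
      OpinionDynamics.Assumption2 B σ C d)
    -- the positive diagonal matrix `Γ`
    (hΓ : ∃ γ : Fin N → ℝ, (∀ i, 0 < γ i) ∧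
      (-(OpinionDynamics.symPart
          (Matrix.diagonal γ * OpinionDynamics.couplingMatrix B σ))).PosSemidef ∧
      (OpinionDynamics.symPart
          (Matrix.diagonal γ * OpinionDynamics.couplingMatrix B σ)).rank =
        (OpinionDynamics.couplingMatrix B σ).rank) :
    -- solutions exist for all times
    (∀ x₀ ∈ OpinionDynamics.opinionCube N, ∃ x : ℝ → Fin N → ℝ,
      OpinionDynamics.IsStubbornNeutralsSolution (OpinionDynamics.couplingMatrix B σ) x ∧
        x 0 = x₀) ∧
    -- the positive eigenvector exists
    (∃ v : Fin N → ℝ, OpinionDynamics.IsPositiveEigenvector C v) ∧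
    -- the critical case
    (d = OpinionDynamics.specRad C →
      ∀ x : ℝ → Fin N → ℝ,
        OpinionDynamics.IsStubbornNeutralsSolution (OpinionDynamics.couplingMatrix B σ) x →
        x 0 ∈ OpinionDynamics.opinionCube N →
        ((∀ i, 0 < x 0 i) →
          ∀ v : Fin N → ℝ, OpinionDynamics.IsPositiveEigenvector C v →
            ∃ α : ℝ, 0 < α ∧
              ((∀ t : ℝ, 0 ≤ t → x t ∈ OpinionDynamics.opinionCube N) → α ≤ 1 / ‖v‖) ∧
              Filter.Tendsto x Filter.atTop (nhds (α • v))) ∧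
        ((∀ i, x 0 i < 0) →
          ∀ v : Fin N → ℝ, OpinionDynamics.IsPositiveEigenvector C v →
            ∃ α : ℝ, α < 0 ∧
              ((∀ t : ℝ, 0 ≤ t → x t ∈ OpinionDynamics.opinionCube N) → -(1 / ‖v‖) ≤ α) ∧
              Filter.Tendsto x Filter.atTop (nhds (α • v))) ∧
        (¬ (∀ i, 0 < x 0 i) → ¬ (∀ i, x 0 i < 0) →
          Filter.Tendsto x Filter.atTop (nhds 0))) ∧
    -- the noncritical case
    (OpinionDynamics.specRad C < d →
      ∀ x : ℝ → Fin N → ℝ,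
        OpinionDynamics.IsStubbornNeutralsSolution (OpinionDynamics.couplingMatrix B σ) x →
        x 0 ∈ OpinionDynamics.opinionCube N →
        Filter.Tendsto x Filter.atTop (nhds 0)) := by
  open OpinionDynamics Matrix in
  obtain ⟨γ, hγ, hH, hrank⟩ := hΓ
  set E := couplingMatrix B σ with hEdef
  obtain ⟨hC, hd, hE⟩ : EventuallyPositive C ∧ specRad C ≤ d ∧
      ∀ y, E *ᵥ y = C *ᵥ y - d • y := by
    have hsmul : ∀ y : Fin N → ℝ, (d • (1 : Matrix (Fin N) (Fin N) ℝ)) *ᵥ y = d • y := fun y => by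
      rw [smul_mulVec, one_mulVec]
    rcases hA with ⟨⟨h1, -, h2⟩, rfl, h3⟩ | ⟨-, h1, h2, h3⟩
    · refine ⟨h1, h3 ⟨0, hN⟩ ▸ h2 ⟨0, hN⟩, fun y => ?_⟩
      have hdiag : diagonal σ = d • (1 : Matrix (Fin N) (Fin N) ℝ) := by
        rw [smul_one_eq_diagonal]
        exact congrArg diagonal (funext h3)
      rw [hEdef, couplingMatrix, hdiag, sub_mulVec, hsmul]
    · refine ⟨h2, h3, fun y => ?_⟩
      have hEC : E = C - d • (1 : Matrix (Fin N) (Fin N) ℝ) := by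
        rw [hEdef, couplingMatrix, h1]
        abel
      rw [hEC, sub_mulVec, hsmul]
  have hD := dissipation_nonneg hH
  have hker : ∀ y, dissipation γ E y = 0 → E *ᵥ y = 0 := fun y =>
    mulVec_eq_zero_of_dissipation_eq_zero hH hrank
  obtain ⟨v₀, hv₀⟩ := hC.exists_isPositiveEigenvector hN
  have hposUniv : specRad C < d → ∀ y ∈ (Set.univ : Set (Fin N → ℝ)), y ≠ 0 →
      0 < dissipation γ E y := by
    intro hlt y _ hy
    refine lt_of_le_of_ne (hD y) fun h => hy ?_
    have h1 := hker y h.symm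
    rw [hE, sub_eq_zero] at h1
    exact hC.eq_zero_of_specRad_lt hN hlt h1
  -- in the critical case the kernel of `E` is spanned by a positive vector, so no nonzero vector
  -- with coordinates of both weak signs lies in it
  have hposMixed : d = specRad C → ∀ i j : Fin N,
      ∀ y ∈ {x : Fin N → ℝ | x i ≤ 0 ∧ 0 ≤ x j}, y ≠ 0 → 0 < dissipation γ E y := by
    intro hcrit i j y hy hne
    refine lt_of_le_of_ne (hD y) fun h => hne ?_
    have h1 := hker y h.symm
    rw [hE, hcrit, sub_eq_zero] at h1
    obtain ⟨s, rfl⟩ := hC.exists_eq_smul hN hv₀ h1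
    have hs1 : s ≤ 0 := nonpos_of_mul_nonpos_left hy.1 (hv₀.1 i)
    have hs2 : 0 ≤ s := nonneg_of_mul_nonneg_left hy.2 (hv₀.1 j)
    rw [le_antisymm hs1 hs2, zero_smul]
  -- the weak signs of two fixed coordinates persist
  have hmixed : ∀ {T : ℝ} {x : ℝ → Fin N → ℝ} {i j : Fin N},
      IsIntegralCurveOn x (fun _ => neutralsField E) (Set.Icc 0 T) → x 0 i ≤ 0 → 0 ≤ x 0 j →
      ∀ t ∈ Set.Icc 0 T, x t ∈ {x : Fin N → ℝ | x i ≤ 0 ∧ 0 ≤ x j} := fun hx hi hj t ht =>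
    ⟨apply_nonpos_of_nonpos hx hi ht, apply_nonneg_of_nonneg hx hj ht⟩
  refine ⟨fun x₀ _ => exists_solution_of_bound ?_, ⟨v₀, hv₀⟩, fun hcrit x hx _ => ?_,
    fun hlt x hx _ => ?_⟩
  · rcases hd.lt_or_eq with hlt | hcrit
    · obtain ⟨R, hR⟩ := exists_norm_bound_of_mem_cone hγ isSignCone_univ (hposUniv hlt) x₀
      exact ⟨R, fun T hT x hx0 hx => hR T hT x hx0 hx fun t _ => Set.mem_univ _⟩
    · have hEv : E *ᵥ v₀ = 0 := by rw [hE, hv₀.2, hcrit, sub_self]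
      by_cases hpos : ∀ i, 0 < x₀ i
      · exact exists_norm_bound_of_pos hγ hD hv₀.1 hEv hpos
      by_cases hneg : ∀ i, x₀ i < 0
      · obtain ⟨R, hR⟩ := exists_norm_bound_of_pos hγ hD hv₀.1 hEv
          (x₀ := -x₀) fun i => neg_pos.2 (hneg i)
        refine ⟨R, fun T hT x hx0 hx => ?_⟩
        have h := hR T hT (fun t => -x t) (by rw [hx0]) (isIntegralCurveOn_neg hx)
        rwa [norm_neg] at h
      push Not at hpos hneg
      obtain ⟨i, hi⟩ := hpos
      obtain ⟨j, hj⟩ := hneg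
      obtain ⟨R, hR⟩ := exists_norm_bound_of_mem_cone hγ (isSignCone_mixed i j)
        (hposMixed hcrit.symm i j) x₀
      exact ⟨R, fun T hT x hx0 hx => hR T hT x hx0 hx
        (hmixed hx (by rwa [hx0]) (by rwa [hx0]))⟩
  · rw [isStubbornNeutralsSolution_iff] at hx
    rw [hcrit] at hE
    refine ⟨fun hpos v hv => exists_tendsto_smul_of_pos hN hγ hC hE hD hker hv hx hpos,
      fun hneg v hv => ?_, fun hpos hneg => ?_⟩
    · obtain ⟨α, hα, hle, hlim⟩ := exists_tendsto_smul_of_pos hN hγ hC hE hD hker hv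
        (isIntegralCurveOn_neg hx) fun i => neg_pos.2 (hneg i)
      refine ⟨-α, neg_neg_of_pos hα, fun hcube => neg_le_neg (hle fun t ht i => ?_), ?_⟩
      · have h := hcube t ht i
        exact ⟨neg_le_neg h.2, neg_le.2 h.1⟩
      · simpa using hlim.neg
    · push Not at hpos hneg
      obtain ⟨i, hi⟩ := hpos
      obtain ⟨j, hj⟩ := hneg
      exact tendsto_zero_of_mem_cone hγ (isSignCone_mixed i j) (hposMixed hcrit i j) hx
        fun t ht => hmixed (hx.mono Set.Icc_subset_Ici_self) hi hj t ⟨ht, le_rfl⟩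
  · rw [isStubbornNeutralsSolution_iff] at hx
    exact tendsto_zero_of_mem_cone hγ isSignCone_univ (hposUniv hlt) hx fun t _ => Set.mem_univ _
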